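/- **Corollary 1.6.** There exist finitely generated simple left orderable groups that admit nontrivial unbounded homogeneous quasimorphisms to $\mathbf R$. More precisely, let $n\ge 3$. There are open connected subsets (intervals) $J_i$ of $\mathbf S^1=\mathbf R/\mathbf Z$ and homeomorphisms $f_i$ of $\mathbf S^1$, indexed by $i\in\mathbf Z/n$, such that 1. the $J_i$ cover $\mathbf S^1$; $J_i\cap J_j=\emptyset$ if $i\ne j$ are not cyclically adjacent; $J_i\cap J_{i+1}$ is nonempty, connected, and a proper subset of both $J_i$ and $J_{i+1}$; and $J_i=\{x\in\mathbf S^1 : x\cdot f_i\ne x\}$; 2. for each $i$ there is exactly one endpoint $x_i$ of $J_{i+1}$ that lies in $J_i$, and $x_i\cdot f_if_{i+1}\cdots f_{i+l}\in J_{i+l+1}$ for all $1\le l\le n$ (right action: $f_i$ is applied first); (so that $G_n=\langle f_i : i\in\mathbf Z/n\rangle$ is a fast $n$-ring group), and such that the derived subgroup $H_n=G_n'$ is finitely generated, simple and left orderable, and its action on $\mathbf S^1$ lifts to a faithful action $\rho$ of $H_n$ on $\mathbf R$ by orientation preserving homeomorphisms commuting with $t\mapsto t+1$, for which the translation number $$\tau(h)=\lim_{k\to\infty}\frac{\rho(h)^k(0)}{k}\qquad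 (h\in H_n)$$ is a homogeneous quasimorphism, i.e. $\sup_{g,h}|\tau(gh)-\tau(g)-\tau(h)|<\infty$ and $\tau(g^k)=k\,\tau(g)$ for all $k\in\mathbf Z$, which is unbounded and nontrivial (not at bounded distance from any homomorphism $H_n\to\mathbf R$). -/

import Mathlib

/-- The circle `ℝ / ℤ`. -/
abbrev Circ : Type := AddCircle (1 : ℝ)

/-- A group is left orderable if it carries a total order invariant under left multiplication. -/
def LeftOrderable (G : Type*) [Group G] : Prop :=
  ∃ r : LinearOrder G, ∀ a b c : G, r.lt b c → r.lt (a * b) (a * c)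

/-- A real valued function on a group that is additive up to a uniformly bounded error. -/
def IsQuasimorphism {G : Type*} [Group G] (φ : G → ℝ) : Prop :=
  ∃ D : ℝ, ∀ g h : G, |φ (g * h) - φ g - φ h| ≤ D

/-- A quasimorphism that is homogeneous: its restriction to every cyclic subgroup is additive. -/
def IsHomogeneousQuasimorphism {G : Type*} [Group G] (φ : G → ℝ) : Prop :=
  IsQuasimorphism φ ∧ ∀ (g : G) (k : ℤ), φ (g ^ k) = k * φ g

/-- A real valued function on a group that is unbounded. -/
def IsUnboundedFun {G : Type*} (φ : G → ℝ) : Prop :=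
  ¬ ∃ C : ℝ, ∀ g : G, |φ g| ≤ C

/-- A function on a group is a nontrivial quasimorphism if it is not at bounded distance from a
homomorphism to the additive group of the reals. -/
def IsNontrivialQuasimorphism {G : Type*} [Group G] (φ : G → ℝ) : Prop :=
  IsQuasimorphism φ ∧
    ∀ ψ : G →* Multiplicative ℝ, IsUnboundedFun fun g => φ g - Multiplicative.toAdd (ψ g)

namespace RingGroup

variable {n : ℕ}

/-- An `n`-ring of intervals and homeomorphisms of the circle; the indices are taken modulo `n`.
The intervals `J i` are open and connected and cover the circle, two of them that are not cyclically
adjacent are disjoint, two that are adjacent meet in a nonempty connected set which is proper in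
both, and `J i` is the support of `f i`. -/
structure IsRing (J : ZMod n → Set Circ) (f : ZMod n → (Circ ≃ₜ Circ)) : Prop where
  isOpen : ∀ i, IsOpen (J i)
  isConnected : ∀ i, IsConnected (J i)
  cover : ⋃ i, J i = Set.univ
  far : ∀ i j, i ≠ j → j ≠ i + 1 → i ≠ j + 1 → Disjoint (J i) (J j)
  near_connected : ∀ i, IsConnected (J i ∩ J (i + 1))
  near_left : ∀ i, J i ∩ J (i + 1) ⊂ J i
  near_right : ∀ i, J i ∩ J (i + 1) ⊂ J (i + 1)
  support : ∀ i, {x | f i x ≠ x} = J i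

/-- The image of `x` after applying first `f i`, then `f (i + 1)`, and so on up to `f (i + l)`
(in right action notation, `x · f i · f (i + 1) ⋯ f (i + l)`). -/
def run (f : ZMod n → (Circ ≃ₜ Circ)) (i : ZMod n) (x : Circ) : ℕ → Circ
  | 0 => f i x
  | l + 1 => f (i + (l + 1 : ℕ)) (run f i x l)

/-- A fast `n`-ring: for every `i`, the unique endpoint `x` of `J (i + 1)` that lies in `J i` is
moved by `f i`, `f (i + 1)`, …, `f (i + l)` (applied in this order) into `J (i + l + 1)`, for all
`1 ≤ l ≤ n`. -/
structure IsFastRing (J : ZMod n → Set Circ) (f : ZMod n → (Circ ≃ₜ Circ)) : Prop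
    extends IsRing J f where
  fast : ∀ i, ∃ x, frontier (J (i + 1)) ∩ J i = {x} ∧
    ∀ l : ℕ, 1 ≤ l → l ≤ n → run f i x l ∈ J (i + l + 1)

/-- The group `G_n` generated by the homeomorphisms of the ring. -/
def ringGroup (f : ZMod n → (Circ ≃ₜ Circ)) : Subgroup (Circ ≃ₜ Circ) :=
  Subgroup.closure (Set.range f)

/-- The derived subgroup `H_n` of `G_n`, as a group of homeomorphisms of the circle. -/
def derivedRingGroup (f : ZMod n → (Circ ≃ₜ Circ)) : Subgroup (Circ ≃ₜ Circ) :=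
  ⁅ringGroup f, ringGroup f⁆

/-- `ρ` is a lift to the real line of the action of a group `H` of homeomorphisms of the circle.
The units of `CircleDeg1Lift` are the increasing bijections of `ℝ` that commute with `x ↦ x + 1`,
that is, the orientation preserving homeomorphisms of `ℝ` that commute with integer translations. -/
def IsLift (H : Subgroup (Circ ≃ₜ Circ)) (ρ : H →* CircleDeg1Liftˣ) : Prop :=
  ∀ (h : H) (t : ℝ), ((ρ h t : ℝ) : Circ) = (h : Circ ≃ₜ Circ) (t : Circ)

/-- The function on `H` that sends `h` to the translation number of `ρ h`, the limit of
`(ρ h)^k (0) / k` as `k` tends to infinity. -/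
noncomputable def transNum {H : Type*} [Group H] (ρ : H →* CircleDeg1Liftˣ) (h : H) : ℝ :=
  CircleDeg1Lift.translationNumber (ρ h : CircleDeg1Lift)

end RingGroup

/-!
The ring is realized on the circle of length `n`, with endpoints at the integers: the interval with
index `k` is `(k, k + 2)`, and its generator is the piecewise linear homeomorphism that has slope
`3` on `[k, k + 1 / 2]` and slope `1 / 3` on `[k + 1 / 2, k + 2]`. It moves the break point
`k + 1 / 2` to the break point `k + 1 + 1 / 2` of the next generator, which gives the fast condition
(`RingGroup.run_ringGen`).

*Dynamics.* On each of the intervals `[k, k + 1 / 2]` and `[k + 1 / 2, k + 1]` a generator or the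
inverse of one expands by the factor `3`. Hence every open set can be moved onto an endpoint,
and from there its complement can be contracted by pushing around the circle. So the ring group `G`
is extremely proximal: the complement of any nonempty open set can be moved into any other
(`RingGroup.isExtremelyProximal_map_liftGroup`).

*Simplicity and finite generation.* These hold for the derived subgroup of every extremely proximal
group generated by finitely many homeomorphisms with non-dense supports
(`ExtremelyProximal.derived_fg_simple`). By the double commutator trick a nontrivial normal subgroup
`N` contains the commutators of elements with a common non-dense support. Since generators have
conjugates with arbitrarily small support, which therefore commute with all generators modulo `N`,
the quotient `G / N` is abelian. Moreover each generator `f` agrees, off a given nonempty open set,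
with a commutator `⁅f, δ⁆`; thus the derived subgroup `H` is itself extremely proximal, which gives
simplicity. Finitely many commutators of this form, with both signs of `f`, generate a normal
subgroup of `G`, because conjugating one of them by a generator amounts to conjugating it by another
one; by the above this subgroup is all of `H`.

*The lift.* Each generator has a unique lift to the line with fixed points. The group of these lifts
contains no nontrivial translation: it preserves the set of points whose orbit under the
expanding map ends in `0`, and `0` is the only integer in that set
(`RingGroup.eq_one_of_circleHomeo_eq_one`). Hence it maps isomorphically onto `G`, and `H` acts
faithfully on the line, which makes it left orderable.

*The quasimorphism.* Suitable commutators move the break points just as the generators do, and their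
product sends `1 / 2` to `n + 1 / 2`, so that it has translation number `1`
(`RingGroup.exists_derived_act_half`). Therefore the translation number is unbounded on `H`; as a
nonabelian simple group has no nonzero homomorphism to `ℝ`, it is nontrivial.
-/

/-! ### Extremely proximal groups of homeomorphisms -/

namespace ExtremelyProximal

open Filter Topology
open scoped commutatorElement

variable {X : Type*} [TopologicalSpace X]

/-- The homeomorphism `g` fixes every point of `W`. -/
def FixesOn (g : X ≃ₜ X) (W : Set X) : Prop := ∀ x ∈ W, g x = x

/-- A group `K` of homeomorphisms is extremely proximal if the complement of every nonempty open
set can be moved by `K` into every nonempty open set. -/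
def IsExtremelyProximal (K : Subgroup (X ≃ₜ X)) : Prop :=
  ∀ W U : Set X, IsOpen W → W.Nonempty → IsOpen U → U.Nonempty → ∃ γ ∈ K, ∀ x, x ∉ W → γ x ∈ U

lemma inv_apply_apply (g : X ≃ₜ X) (x : X) : g⁻¹ (g x) = x := by
  rw [← Homeomorph.mul_apply, inv_mul_cancel]; rfl

lemma apply_inv_apply (g : X ≃ₜ X) (x : X) : g (g⁻¹ x) = x := by
  rw [← Homeomorph.mul_apply, mul_inv_cancel]; rfl

lemma FixesOn.inv {g : X ≃ₜ X} {W : Set X} (h : FixesOn g W) : FixesOn g⁻¹ W := fun x hx => by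
  conv_lhs => rw [← h x hx]
  exact inv_apply_apply g x

lemma FixesOn.mul {g h : X ≃ₜ X} {W : Set X} (hg : FixesOn g W) (hh : FixesOn h W) :
    FixesOn (g * h) W := fun x hx => by rw [Homeomorph.mul_apply, hh x hx, hg x hx]

lemma FixesOn.mono {g : X ≃ₜ X} {W V : Set X} (h : FixesOn g W) (hV : V ⊆ W) : FixesOn g V :=
  fun x hx => h x (hV hx)

lemma FixesOn.conj {g : X ≃ₜ X} {W V : Set X} (h : FixesOn g W) {γ : X ≃ₜ X}
    (hγ : ∀ x ∈ V, γ⁻¹ x ∈ W) : FixesOn (γ * g * γ⁻¹) V := fun x hx => by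
  rw [Homeomorph.mul_apply, Homeomorph.mul_apply, h _ (hγ x hx), apply_inv_apply]

/-- If `γ` moves the complement of `W` into `U`, then conjugation by `γ` turns a homeomorphism
supported off `W` into one supported in `U`. -/
lemma FixesOn.conj_compl {g : X ≃ₜ X} {W U : Set X} (h : FixesOn g W) {γ : X ≃ₜ X}
    (hγ : ∀ x, x ∉ W → γ x ∈ U) : FixesOn (γ * g * γ⁻¹) Uᶜ :=
  h.conj fun x hx => by
    by_contra hW
    exact hx (by simpa only [apply_inv_apply] using hγ _ hW)

lemma commute_of_disjoint {a b : X ≃ₜ X} {U V : Set X} (ha : FixesOn a Uᶜ) (hb : FixesOn b Vᶜ)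
    (hUV : Disjoint U V) : Commute a b := by
  have key : Equiv.Perm.Disjoint (a.toEquiv : Equiv.Perm X) b.toEquiv := fun x => by
    by_cases hx : x ∈ U
    · exact Or.inr (hb x (Set.disjoint_left.1 hUV hx))
    · exact Or.inl (ha x hx)
  have := key.commute.eq
  ext x
  exact Equiv.congr_fun this x

lemma exists_ne_of_ne_one {g : X ≃ₜ X} (hg : g ≠ 1) : ∃ x, g x ≠ x := by
  by_contra! h
  exact hg (by ext x; exact h x)

/-- Near a point moved by `g` there is an open set disjoint from its image. -/
lemma exists_isOpen_move [T2Space X] {g : X ≃ₜ X} {x : X} (hx : g x ≠ x) {U : Set X}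
    (hU : IsOpen U) (hxU : x ∈ U) :
    ∃ V ⊆ U, IsOpen V ∧ x ∈ V ∧ ∀ y ∈ V, g y ∉ V := by
  obtain ⟨A, B, hA, hB, hgA, hxB, hAB⟩ := t2_separation hx
  refine ⟨U ∩ (B ∩ g ⁻¹' A), Set.inter_subset_left,
    hU.inter (hB.inter (hA.preimage g.continuous)), ⟨hxU, hxB, hgA⟩, ?_⟩
  intro y hy hy'
  exact Set.disjoint_left.1 hAB hy.2.2 hy'.2.1

/-- The double commutator trick: a subgroup `N` normalized by an extremely proximal group `K` and
containing a nontrivial element contains the commutator of any two elements of `K` that are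
supported off a common nonempty open set. -/
lemma commutator_mem [T2Space X] {K N : Subgroup (X ≃ₜ X)} (hK : IsExtremelyProximal K)
    (hN : ∀ k ∈ K, ∀ x ∈ N, k * x * k⁻¹ ∈ N) {g : X ≃ₜ X} (hgN : g ∈ N) (hg : g ≠ 1)
    {a b : X ≃ₜ X} (ha : a ∈ K) (hb : b ∈ K) {W : Set X} (hW : IsOpen W) (hW' : W.Nonempty)
    (haW : FixesOn a W) (hbW : FixesOn b W) : ⁅a, b⁆ ∈ N := by
  obtain ⟨x, hx⟩ := exists_ne_of_ne_one hg
  obtain ⟨U, -, hU, hxU, hgU⟩ := exists_isOpen_move hx isOpen_univ (Set.mem_univ x)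
  obtain ⟨γ, hγ, hγU⟩ := hK W U hW hW' hU ⟨x, hxU⟩
  have small : ∀ c d : X ≃ₜ X, c ∈ K → d ∈ K → FixesOn c Uᶜ → FixesOn d Uᶜ → ⁅c, d⁆ ∈ N := by
    intro c d hc hd hcU hdU
    have hc' : FixesOn (g * c⁻¹ * g⁻¹) {y | g⁻¹ y ∈ U}ᶜ := hcU.inv.conj fun y hy => hy
    have disj : Disjoint {y | g⁻¹ y ∈ U} U := Set.disjoint_left.2 fun y hy hy' =>
      hgU _ hy (by rwa [apply_inv_apply])
    have h1 := (commute_of_disjoint hc' hcU disj).eq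
    have h2 := (commute_of_disjoint hc' hdU disj).eq
    have h3 : ⁅c, g⁆ ∈ N := by
      rw [commutatorElement_def]
      exact mul_mem (hN c hc g hgN) (inv_mem hgN)
    have h4 : ⁅⁅c, g⁆, d⁆ ∈ N := by
      have : ⁅⁅c, g⁆, d⁆ = ⁅c, g⁆ * (d * ⁅c, g⁆⁻¹ * d⁻¹) := by
        simp only [commutatorElement_def]; group
      rw [this]
      exact mul_mem h3 (hN d hd _ (inv_mem h3))
    have h5 : ⁅⁅c, g⁆, d⁆ = ⁅c, d⁆ := by
      have e : ⁅c, g⁆ = c * (g * c⁻¹ * g⁻¹) := by simp only [commutatorElement_def]; group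
      rw [e]
      generalize g * c⁻¹ * g⁻¹ = e at h1 h2
      calc ⁅c * e, d⁆ = c * (e * d) * e⁻¹ * c⁻¹ * d⁻¹ := by
            simp only [commutatorElement_def]; group
        _ = ⁅c, d⁆ := by rw [h2]; simp only [commutatorElement_def]; group
    rwa [h5] at h4
  have h := small _ _ (mul_mem (mul_mem hγ ha) (inv_mem hγ)) (mul_mem (mul_mem hγ hb) (inv_mem hγ))
    (haW.conj_compl hγU) (hbW.conj_compl hγU)
  have h' := hN γ⁻¹ (inv_mem hγ) _ h
  rwa [show γ⁻¹ * ⁅γ * a * γ⁻¹, γ * b * γ⁻¹⁆ * γ⁻¹⁻¹ = ⁅a, b⁆ by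
    simp only [commutatorElement_def]; group] at h'

section Generators

variable {ι : Type*} {f : ι → (X ≃ₜ X)}

/-- In a perfect Hausdorff space, finitely many nonempty open sets contain pairwise disjoint
nonempty open subsets. -/
lemma exists_disjoint_isOpen [T2Space X] [∀ x : X, NeBot (𝓝[≠] x)] [Finite ι] {W : ι → Set X}
    (hW : ∀ i, IsOpen (W i)) (hW' : ∀ i, (W i).Nonempty) :
    ∃ O : ι → Set X, (∀ i, IsOpen (O i)) ∧ (∀ i, (O i).Nonempty) ∧ (∀ i, O i ⊆ W i) ∧
      ∀ i j, i ≠ j → Disjoint (O i) (O j) := by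
  classical
  have := Fintype.ofFinite ι
  have inf : ∀ i, (W i).Infinite := fun i =>
    infinite_of_mem_nhds _ ((hW i).mem_nhds (hW' i).some_mem)
  choose t ht htc using fun i => (inf i).exists_subset_card_eq (Fintype.card ι)
  obtain ⟨p, hp, hpt⟩ := (Finset.all_card_le_biUnion_card_iff_exists_injective t).1 fun s => by
    rcases s.eq_empty_or_nonempty with rfl | ⟨i, hi⟩
    · simp
    · calc s.card ≤ Fintype.card ι := Finset.card_le_univ s
        _ = (t i).card := (htc i).symm
        _ ≤ _ := Finset.card_le_card (Finset.subset_biUnion_of_mem t hi)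
  obtain ⟨V, hV, hd⟩ := (Set.finite_range p).t2_separation
  refine ⟨fun i => W i ∩ V (p i), fun i => (hW i).inter (hV _).2,
    fun i => ⟨p i, ht i (hpt i), (hV _).1⟩, fun i => Set.inter_subset_left, fun i j hij => ?_⟩
  exact (hd ⟨i, rfl⟩ ⟨j, rfl⟩ (hp.ne hij)).mono Set.inter_subset_right Set.inter_subset_right

variable {O : ι × Bool → Set X}

/-- In an extremely proximal group, conjugates of a generator can be given so small a support that
they commute with all generators modulo a given nontrivial normal subgroup; hence the quotient is
abelian. -/
lemma commutator_le_of_normalized [T2Space X]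
    (hG : IsExtremelyProximal (Subgroup.closure (Set.range f)))
    (hO : ∀ p, IsOpen (O p)) (hO' : ∀ p, (O p).Nonempty) (hOf : ∀ p, FixesOn (f p.1) (O p))
    (hOd : ∀ p q, p ≠ q → Disjoint (O p) (O q)) {N : Subgroup (X ≃ₜ X)}
    (hN : ∀ k ∈ Subgroup.closure (Set.range f), ∀ x ∈ N, k * x * k⁻¹ ∈ N)
    {g : X ≃ₜ X} (hgN : g ∈ N) (hg : g ≠ 1) :
    ⁅Subgroup.closure (Set.range f), Subgroup.closure (Set.range f)⁆ ≤ N := by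
  set G := Subgroup.closure (Set.range f) with hGdef
  have hf : ∀ i, f i ∈ G := fun i => Subgroup.subset_closure ⟨i, rfl⟩
  -- Being central modulo `N` can be tested on generators, in both arguments.
  have right : ∀ a ∈ G, (∀ j, ⁅a, f j⁆ ∈ N) → ∀ x ∈ G, ⁅a, x⁆ ∈ N := by
    intro a ha haf x hx
    induction hx using Subgroup.closure_induction with
    | mem x hx => obtain ⟨j, rfl⟩ := hx; exact haf j
    | one => simp
    | mul x y hx hy ihx ihy =>
      rw [show ⁅a, x * y⁆ = ⁅a, x⁆ * (x * ⁅a, y⁆ * x⁻¹) by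
        simp only [commutatorElement_def]; group]
      exact mul_mem ihx (hN x hx _ ihy)
    | inv x hx ihx =>
      rw [show ⁅a, x⁻¹⁆ = x⁻¹ * ⁅a, x⁆⁻¹ * x⁻¹⁻¹ by simp only [commutatorElement_def]; group]
      exact hN _ (inv_mem hx) _ (inv_mem ihx)
  rw [Subgroup.commutator_le]
  intro a ha x hx
  have left : ∀ i, ∀ x ∈ G, ⁅f i, x⁆ ∈ N := by
    intro i x hx
    obtain ⟨γ, hγ, hγU⟩ := hG (O (i, true)) (O (i, true)) (hO _) (hO' _) (hO _) (hO' _)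
    have hc : γ * f i * γ⁻¹ ∈ G := mul_mem (mul_mem hγ (hf i)) (inv_mem hγ)
    have h := right (γ * f i * γ⁻¹) hc (fun j => by
      refine commutator_mem hG hN hgN hg hc (hf j) (hO (j, false)) (hO' _) ?_ (hOf (j, false))
      exact ((hOf (i, true)).conj_compl hγU).mono
        (Set.subset_compl_iff_disjoint_right.2 (hOd _ _ (by simp)))) (γ * x * γ⁻¹)
      (mul_mem (mul_mem hγ hx) (inv_mem hγ))
    have h' := hN γ⁻¹ (inv_mem hγ) _ h
    rwa [show γ⁻¹ * ⁅γ * f i * γ⁻¹, γ * x * γ⁻¹⁆ * γ⁻¹⁻¹ = ⁅f i, x⁆ by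
      simp only [commutatorElement_def]; group] at h'
  have h := right x hx (fun j => by
    rw [← commutatorElement_inv]
    exact inv_mem (left j x hx)) a ha
  rw [← commutatorElement_inv]
  exact inv_mem h

/-- Off a nonempty open set, every element of an extremely proximal group agrees with an element of
the derived subgroup: each generator `f i` may be replaced by `⁅f i, δ⁆`, where `δ` conjugates
`f i` to a homeomorphism with small support. -/
lemma exists_derived_eqOn (hG : IsExtremelyProximal (Subgroup.closure (Set.range f)))
    (hO : ∀ p, IsOpen (O p)) (hO' : ∀ p, (O p).Nonempty) (hOf : ∀ p, FixesOn (f p.1) (O p))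
    {γ : X ≃ₜ X} (hγ : γ ∈ Subgroup.closure (Set.range f)) :
    ∀ W : Set X, IsOpen W → W.Nonempty →
      ∃ h ∈ ⁅Subgroup.closure (Set.range f), Subgroup.closure (Set.range f)⁆,
        ∀ x, x ∉ W → h x = γ x := by
  induction hγ using Subgroup.closure_induction with
  | mem x hx =>
    obtain ⟨i, rfl⟩ := hx
    intro W hW hW'
    obtain ⟨δ, hδ, hδW⟩ := hG (O (i, true)) W (hO _) (hO' _) hW hW'
    refine ⟨⁅f i, δ⁆, Subgroup.commutator_mem_commutator (Subgroup.subset_closure ⟨i, rfl⟩) hδ, ?_⟩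
    intro x hx
    rw [show ⁅f i, δ⁆ = f i * (δ * (f i)⁻¹ * δ⁻¹) by simp only [commutatorElement_def]; group,
      Homeomorph.mul_apply, (hOf (i, true)).inv.conj_compl hδW x hx]
  | one => exact fun W _ _ => ⟨1, one_mem _, fun x _ => rfl⟩
  | mul a b _ _ iha ihb =>
    intro W hW hW'
    obtain ⟨h, hh, hhW⟩ := ihb W hW hW'
    obtain ⟨k, hk, hkW⟩ := iha ((b⁻¹ : X ≃ₜ X) ⁻¹' W) (hW.preimage b⁻¹.continuous)
      ⟨b hW'.some, by rw [Set.mem_preimage, inv_apply_apply]; exact hW'.some_mem⟩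
    refine ⟨k * h, mul_mem hk hh, fun x hx => ?_⟩
    rw [Homeomorph.mul_apply, Homeomorph.mul_apply, hhW x hx, hkW]
    rwa [Set.mem_preimage, inv_apply_apply]
  | inv a _ iha =>
    intro W hW hW'
    obtain ⟨h, hh, hhW⟩ := iha (a ⁻¹' W) (hW.preimage a.continuous)
      ⟨a⁻¹ hW'.some, by rw [Set.mem_preimage, apply_inv_apply]; exact hW'.some_mem⟩
    refine ⟨h⁻¹, inv_mem hh, fun x hx => ?_⟩
    have := hhW (a⁻¹ x) (by rwa [Set.mem_preimage, apply_inv_apply])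
    rw [apply_inv_apply] at this
    conv_lhs => rw [← this]
    exact inv_apply_apply h _

lemma isExtremelyProximal_derived (hG : IsExtremelyProximal (Subgroup.closure (Set.range f)))
    (hO : ∀ p, IsOpen (O p)) (hO' : ∀ p, (O p).Nonempty) (hOf : ∀ p, FixesOn (f p.1) (O p)) :
    IsExtremelyProximal
      ⁅Subgroup.closure (Set.range f), Subgroup.closure (Set.range f)⁆ := by
  intro W U hW hW' hU hU'
  obtain ⟨γ, hγ, hγU⟩ := hG W U hW hW' hU hU'
  obtain ⟨h, hh, hhW⟩ := exists_derived_eqOn hG hO hO' hOf hγ W hW hW'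
  exact ⟨h, hh, fun x hx => by rw [hhW x hx]; exact hγU x hx⟩

lemma exists_disjoint_isOpen_pair [T2Space X] [∀ x : X, NeBot (𝓝[≠] x)] {U : Set X}
    (hU : IsOpen U) (hU' : U.Nonempty) :
    ∃ V V' : Set X, IsOpen V ∧ IsOpen V' ∧ V.Nonempty ∧ V'.Nonempty ∧ V ⊆ U ∧ V' ⊆ U ∧
      Disjoint V V' := by
  obtain ⟨O, h1, h2, h3, h4⟩ := exists_disjoint_isOpen (W := fun _ : Bool => U) (fun _ => hU)
    (fun _ => hU')
  exact ⟨O true, O false, h1 _, h1 _, h2 _, h2 _, h3 _, h3 _, h4 _ _ (by simp)⟩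

/-- The derived subgroup has nontrivial elements supported in any nonempty open set `U`: take the
quotient of two conjugates of a generator, supported in disjoint parts of `U`. -/
lemma exists_derived_fixesOn_compl [T2Space X] [∀ x : X, NeBot (𝓝[≠] x)]
    (hG : IsExtremelyProximal (Subgroup.closure (Set.range f)))
    (hO : ∀ p, IsOpen (O p)) (hO' : ∀ p, (O p).Nonempty) (hOf : ∀ p, FixesOn (f p.1) (O p))
    {i : ι} (hi : f i ≠ 1) {U : Set X} (hU : IsOpen U) (hU' : U.Nonempty) :
    ∃ h ∈ ⁅Subgroup.closure (Set.range f), Subgroup.closure (Set.range f)⁆,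
      FixesOn h Uᶜ ∧ ∃ x ∈ U, h x ≠ x := by
  obtain ⟨V, V', hV, hV', hne, hne', hVU, hVU', hd⟩ := exists_disjoint_isOpen_pair hU hU'
  obtain ⟨δ, hδ, hδV⟩ := hG (O (i, true)) V (hO _) (hO' _) hV hne
  obtain ⟨ε, hε, hεV⟩ := hG (O (i, true)) V' (hO _) (hO' _) hV' hne'
  have hf : f i ∈ Subgroup.closure (Set.range f) := Subgroup.subset_closure ⟨i, rfl⟩
  have h1 := (hOf (i, true)).conj_compl hδV
  have h2 := (hOf (i, true)).inv.conj_compl hεV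
  obtain ⟨x, hx⟩ := exists_ne_of_ne_one (g := δ * f i * δ⁻¹) fun h =>
    hi (conj_eq_one_iff.1 h)
  have hxV : x ∈ V := by
    by_contra hxV
    exact hx (h1 x hxV)
  refine ⟨(δ * f i * δ⁻¹) * (ε * (f i)⁻¹ * ε⁻¹), ?_, ?_, x, hVU hxV, ?_⟩
  · rw [show (δ * f i * δ⁻¹) * (ε * (f i)⁻¹ * ε⁻¹) = ⁅δ, f i⁆ * ⁅ε, f i⁆⁻¹ by
      simp only [commutatorElement_def]; group]
    exact mul_mem (Subgroup.commutator_mem_commutator hδ hf)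
      (inv_mem (Subgroup.commutator_mem_commutator hε hf))
  · exact (h1.mono (Set.compl_subset_compl.2 hVU)).mul (h2.mono (Set.compl_subset_compl.2 hVU'))
  · rw [Homeomorph.mul_apply, h2 x (Set.disjoint_left.1 hd hxV)]
    exact hx

lemma exists_derived_commutator_ne_one [T2Space X] [∀ x : X, NeBot (𝓝[≠] x)]
    (hG : IsExtremelyProximal (Subgroup.closure (Set.range f)))
    (hO : ∀ p, IsOpen (O p)) (hO' : ∀ p, (O p).Nonempty) (hOf : ∀ p, FixesOn (f p.1) (O p))
    {i : ι} (hi : f i ≠ 1) {U : Set X} (hU : IsOpen U) (hU' : U.Nonempty) :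
    ∃ a ∈ ⁅Subgroup.closure (Set.range f), Subgroup.closure (Set.range f)⁆,
      ∃ b ∈ ⁅Subgroup.closure (Set.range f), Subgroup.closure (Set.range f)⁆,
        FixesOn a Uᶜ ∧ FixesOn b Uᶜ ∧ ⁅a, b⁆ ≠ 1 := by
  obtain ⟨a, ha, haU, x, hxU, hx⟩ := exists_derived_fixesOn_compl hG hO hO' hOf hi hU hU'
  obtain ⟨V, hVU, hV, hxV, hVa⟩ := exists_isOpen_move hx hU hxU
  obtain ⟨b, hb, hbV, y, hyV, hy⟩ := exists_derived_fixesOn_compl hG hO hO' hOf hi hV ⟨x, hxV⟩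
  refine ⟨a, ha, b, hb, haU, hbV.mono (Set.compl_subset_compl.2 hVU), fun h => hy ?_⟩
  have h1 : a * b = b * a := commutatorElement_eq_one_iff_mul_comm.1 h
  have h2 : a (b y) = b (a y) := by
    rw [← Homeomorph.mul_apply, h1, Homeomorph.mul_apply]
  rw [hbV _ (hVa y hyV)] at h2
  exact a.injective h2

/-- A nontrivial subgroup of homeomorphisms normalized by the derived subgroup contains it. -/
lemma derived_le_of_normalized [T2Space X] [∀ x : X, NeBot (𝓝[≠] x)]
    (hG : IsExtremelyProximal (Subgroup.closure (Set.range f)))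
    (hO : ∀ p, IsOpen (O p)) (hO' : ∀ p, (O p).Nonempty) (hOf : ∀ p, FixesOn (f p.1) (O p))
    (hOd : ∀ p q, p ≠ q → Disjoint (O p) (O q)) {i : ι} (hi : f i ≠ 1) {N : Subgroup (X ≃ₜ X)}
    (hN : ∀ k ∈ ⁅Subgroup.closure (Set.range f), Subgroup.closure (Set.range f)⁆,
      ∀ x ∈ N, k * x * k⁻¹ ∈ N)
    {g : X ≃ₜ X} (hgN : g ∈ N) (hg : g ≠ 1) :
    ⁅Subgroup.closure (Set.range f), Subgroup.closure (Set.range f)⁆ ≤ N := by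
  set G := Subgroup.closure (Set.range f) with hGdef
  have hH := isExtremelyProximal_derived hG hO hO' hOf
  -- The commutators of pairs in `⁅G, G⁆` with a common non-dense support form a set that is
  -- invariant under all of `G`, not only under `⁅G, G⁆`.
  set S : Set (X ≃ₜ X) := {c | ∃ a ∈ ⁅G, G⁆, ∃ b ∈ ⁅G, G⁆, ∃ W : Set X, IsOpen W ∧ W.Nonempty ∧
    FixesOn a W ∧ FixesOn b W ∧ ⁅a, b⁆ = c} with hS
  have conj_derived : ∀ k ∈ G, ∀ a ∈ ⁅G, G⁆, k * a * k⁻¹ ∈ ⁅G, G⁆ := by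
    intro k hk a ha
    have ha' : a ∈ G := Subgroup.commutator_le_self G ha
    rw [show k * a * k⁻¹ = ⁅k, a⁆ * a by simp only [commutatorElement_def]; group]
    exact mul_mem (Subgroup.commutator_mem_commutator hk ha') ha
  have hSN : Subgroup.closure S ≤ N := by
    rw [Subgroup.closure_le]
    rintro c ⟨a, ha, b, hb, W, hW, hW', haW, hbW, rfl⟩
    exact commutator_mem hH hN hgN hg ha hb hW hW' haW hbW
  have hSG : ∀ k ∈ G, ∀ x ∈ Subgroup.closure S, k * x * k⁻¹ ∈ Subgroup.closure S := by
    intro k hk x hx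
    induction hx using Subgroup.closure_induction with
    | mem x hx =>
      obtain ⟨a, ha, b, hb, W, hW, hW', haW, hbW, rfl⟩ := hx
      refine Subgroup.subset_closure ⟨k * a * k⁻¹, conj_derived k hk a ha, k * b * k⁻¹,
        conj_derived k hk b hb, (k⁻¹ : X ≃ₜ X) ⁻¹' W, hW.preimage k⁻¹.continuous,
        ⟨k hW'.some, by rw [Set.mem_preimage, inv_apply_apply]; exact hW'.some_mem⟩,
        haW.conj fun x hx => hx, hbW.conj fun x hx => hx, ?_⟩
      simp only [commutatorElement_def]; group
    | one => simp
    | mul x y _ _ ihx ihy =>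
      rw [show k * (x * y) * k⁻¹ = (k * x * k⁻¹) * (k * y * k⁻¹) by group]
      exact mul_mem ihx ihy
    | inv x _ ihx =>
      rw [show k * x⁻¹ * k⁻¹ = (k * x * k⁻¹)⁻¹ by group]
      exact inv_mem ihx
  obtain ⟨a, ha, b, hb, haU, hbU, hab⟩ :=
    exists_derived_commutator_ne_one hG hO hO' hOf hi (hO (i, true)) (hO' _)
  have hsub : O (i, false) ⊆ (O (i, true))ᶜ :=
    Set.subset_compl_iff_disjoint_right.2 (hOd _ _ (by simp))
  exact (commutator_le_of_normalized hG hO hO' hOf hOd hSG (Subgroup.subset_closure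
    ⟨a, ha, b, hb, O (i, false), hO _, hO' _, haU.mono hsub, hbU.mono hsub, rfl⟩) hab).trans hSN

/-- The derived subgroup is finitely generated. Finitely many commutators `⁅(f j)^±1, δ⁆` generate
a subgroup normalized by all `f k`, because conjugation by `f k` acts on such a commutator as
conjugation by another one of them. -/
lemma derived_fg [T2Space X] [Finite ι] [∀ x : X, NeBot (𝓝[≠] x)]
    (hG : IsExtremelyProximal (Subgroup.closure (Set.range f)))
    (hO : ∀ p, IsOpen (O p)) (hO' : ∀ p, (O p).Nonempty) (hOf : ∀ p, FixesOn (f p.1) (O p))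
    (hOd : ∀ p q, p ≠ q → Disjoint (O p) (O q)) {i : ι} (hi : f i ≠ 1) :
    Subgroup.FG ⁅Subgroup.closure (Set.range f), Subgroup.closure (Set.range f)⁆ := by
  set G := Subgroup.closure (Set.range f) with hGdef
  have hf : ∀ i, f i ∈ G := fun i => Subgroup.subset_closure ⟨i, rfl⟩
  choose δ hδ hδO using fun (j : ι) (p : ι × Bool) =>
    hG (O (j, true) ∪ O (j, false)) (O p) ((hO _).union (hO _)) ((hO' _).inl) (hO p) (hO' p)
  have hfix : ∀ j, FixesOn (f j) (O (j, true) ∪ O (j, false)) := fun j x hx =>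
    hx.elim (hOf (j, true) x) (hOf (j, false) x)
  have hfix' : ∀ j (s : Bool), FixesOn (cond s (f j) (f j)⁻¹) (O (j, true) ∪ O (j, false)) := by
    rintro j (_ | _)
    · exact (hfix j).inv
    · exact hfix j
  have hmem : ∀ j (s : Bool), cond s (f j) (f j)⁻¹ ∈ G := by
    rintro j (_ | _)
    · exact inv_mem (hf j)
    · exact hf j
  set c : ι × Bool × ι × Bool → (X ≃ₜ X) :=
    fun q => ⁅cond q.2.1 (f q.1) (f q.1)⁻¹, δ q.1 q.2.2⁆ with hc
  set K := Subgroup.closure (Set.range c) with hK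
  have hcK : ∀ q, c q ∈ K := fun q => Subgroup.subset_closure ⟨q, rfl⟩
  have hKG : K ≤ ⁅G, G⁆ := by
    rw [hK, Subgroup.closure_le]
    rintro _ ⟨q, rfl⟩
    exact Subgroup.commutator_mem_commutator (hmem _ _) (hδ _ _)
  -- Conjugation by a generator or its inverse preserves `K`.
  have conj_gen : ∀ k (s : Bool) q,
      cond s (f k) (f k)⁻¹ * c q * (cond s (f k) (f k)⁻¹)⁻¹ ∈ K := by
    rintro k s ⟨j, t, p⟩
    -- `O (j, m)` avoids the support of `c (j, t, p)`.
    obtain ⟨m, hm⟩ : ∃ m : Bool, (j, m) ≠ p := by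
      by_cases h : (j, true) = p
      · exact ⟨false, by rw [← h]; simp⟩
      · exact ⟨true, h⟩
    set u := cond s (f k) (f k)⁻¹ with hu
    set v := δ k (j, m) with hv
    have hc1 : FixesOn (c (j, t, p)) (O (j, m)) := by
      rw [show c (j, t, p) = cond t (f j) (f j)⁻¹ *
        (δ j p * (cond t (f j) (f j)⁻¹)⁻¹ * (δ j p)⁻¹) by
          simp only [hc, commutatorElement_def]; group]
      refine FixesOn.mul ((hfix' j t).mono ?_) (((hfix' j t).inv.conj_compl (hδO j p)).mono ?_)
      · cases m
        · exact Set.subset_union_right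
        · exact Set.subset_union_left
      · exact Set.subset_compl_iff_disjoint_right.2 (hOd _ _ hm)
    have hcomm : Commute (v * u⁻¹ * v⁻¹) (c (j, t, p)) := by
      refine commute_of_disjoint ((hfix' k s).inv.conj_compl (hδO k (j, m)))
        (V := (O (j, m))ᶜ) (by rwa [compl_compl]) ?_
      exact disjoint_compl_right
    have hcomm' : u * c (j, t, p) * u⁻¹ = ⁅u, v⁆ * c (j, t, p) * ⁅u, v⁆⁻¹ := by
      rw [show ⁅u, v⁆ = u * (v * u⁻¹ * v⁻¹) by simp only [commutatorElement_def]; group,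
        mul_assoc u (v * u⁻¹ * v⁻¹), hcomm.eq]
      group
    rw [hcomm']
    exact mul_mem (mul_mem (hcK (k, s, j, m)) (hcK _)) (inv_mem (hcK (k, s, j, m)))
  have conj_gen' : ∀ k (s : Bool), ∀ x ∈ K,
      cond s (f k) (f k)⁻¹ * x * (cond s (f k) (f k)⁻¹)⁻¹ ∈ K := by
    intro k s x hx
    generalize hu : cond s (f k) (f k)⁻¹ = u
    induction hx using Subgroup.closure_induction with
    | mem x hx =>
      obtain ⟨q, rfl⟩ := hx
      rw [← hu]
      exact conj_gen k s q
    | one => simp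
    | mul x y _ _ ihx ihy =>
      rw [show u * (x * y) * u⁻¹ = (u * x * u⁻¹) * (u * y * u⁻¹) by group]
      exact mul_mem ihx ihy
    | inv x _ ihx =>
      rw [show u * x⁻¹ * u⁻¹ = (u * x * u⁻¹)⁻¹ by group]
      exact inv_mem ihx
  have hKnorm : ∀ k ∈ G, ∀ x ∈ K, k * x * k⁻¹ ∈ K := by
    intro k hk
    induction hk using Subgroup.closure_induction'' with
    | mem k hk => obtain ⟨j, rfl⟩ := hk; exact conj_gen' j true
    | inv_mem k hk => obtain ⟨j, rfl⟩ := hk; exact conj_gen' j false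
    | one => intro x hx; simpa using hx
    | mul a b _ _ iha ihb =>
      intro x hx
      rw [show a * b * x * (a * b)⁻¹ = a * (b * x * b⁻¹) * a⁻¹ by group]
      exact iha _ (ihb x hx)
  -- The commutator of `f i` with an element moving its support off itself is not trivial.
  have hne : c (i, true, i, true) ≠ 1 := by
    intro h
    have h1 : f i * δ i (i, true) = δ i (i, true) * f i :=
      commutatorElement_eq_one_iff_mul_comm.1 h
    have h2 : δ i (i, true) * f i * (δ i (i, true))⁻¹ = f i := by rw [← h1]; group
    have h3 := (hfix i).conj_compl (hδO i (i, true))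
    rw [h2] at h3
    refine hi (Homeomorph.ext fun x => ?_)
    by_cases hx : x ∈ O (i, true)
    · exact hOf (i, true) x hx
    · exact h3 x hx
  have hKH : K = ⁅G, G⁆ := le_antisymm hKG
    (commutator_le_of_normalized hG hO hO' hOf hOd hKnorm (hcK _) hne)
  rw [← hKH, hK, Subgroup.fg_iff]
  exact ⟨_, rfl, Set.finite_range c⟩

end Generators

/-- An extremely proximal group generated by finitely many homeomorphisms, each of which is the
identity on a nonempty open set, has a finitely generated, simple and nonabelian derived subgroup.
-/
theorem derived_fg_simple [T2Space X] [∀ x : X, NeBot (𝓝[≠] x)] {ι : Type*} [Finite ι]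
    {f : ι → (X ≃ₜ X)} (hG : IsExtremelyProximal (Subgroup.closure (Set.range f)))
    (hf : ∀ i, ∃ W, IsOpen W ∧ W.Nonempty ∧ FixesOn (f i) W) {i : ι} (hi : f i ≠ 1)
    {H : Subgroup (X ≃ₜ X)}
    (hH : H = ⁅Subgroup.closure (Set.range f), Subgroup.closure (Set.range f)⁆) :
    Group.FG H ∧ IsSimpleGroup H ∧ ∃ a b : H, ⁅a, b⁆ ≠ 1 := by
  choose W hW hW' hWf using hf
  obtain ⟨O, hO, hO', hOW, hOd⟩ := exists_disjoint_isOpen (W := fun p : ι × Bool => W p.1)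
    (fun p => hW p.1) (fun p => hW' p.1)
  have hOf : ∀ p : ι × Bool, FixesOn (f p.1) (O p) := fun p => (hWf p.1).mono (hOW p)
  obtain ⟨a, ha, b, hb, -, -, hab⟩ :=
    exists_derived_commutator_ne_one hG hO hO' hOf hi (hO (i, true)) (hO' _)
  rw [← hH] at ha hb
  have hab' : ⁅(⟨a, ha⟩ : H), (⟨b, hb⟩ : H)⁆ ≠ 1 := fun h => hab (congrArg Subtype.val h)
  refine ⟨?_, ?_, _, _, hab'⟩
  · rw [Group.fg_iff_subgroup_fg, hH]
    exact derived_fg hG hO hO' hOf hOd hi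
  · have : Nontrivial H := ⟨⟨_, _, hab'⟩⟩
    refine ⟨fun N hN => ?_⟩
    by_cases hbot : N = ⊥
    · exact Or.inl hbot
    right
    obtain ⟨⟨g, hg⟩, hg1⟩ := N.ne_bot_iff_exists_ne_one.1 hbot
    have hle : H ≤ N.map H.subtype := by
      conv_lhs => rw [hH]
      refine derived_le_of_normalized hG hO hO' hOf hOd hi ?_
        (g := ((g : H) : X ≃ₜ X)) ⟨g, hg, rfl⟩ fun h => hg1 (Subtype.ext (Subtype.ext h))
      rw [← hH]
      rintro k hk _ ⟨x, hx, rfl⟩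
      exact ⟨⟨k, hk⟩ * x * ⟨k, hk⟩⁻¹, hN.conj_mem x hx _, rfl⟩
    rw [eq_top_iff]
    intro x _
    obtain ⟨y, hy, hyx⟩ := hle x.2
    rwa [← Subtype.ext hyx]

end ExtremelyProximal

/-! ### Homeomorphisms of the circle with a lift to the line -/

namespace RingGroup

open Set Topology
open scoped commutatorElement

lemma lift_strictMono (g : CircleDeg1Liftˣ) : StrictMono g :=
  (CircleDeg1Lift.toOrderIso g).strictMono

lemma lift_continuous (g : CircleDeg1Liftˣ) : Continuous g :=
  (CircleDeg1Lift.toOrderIso g).continuous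

lemma mul_lift_apply (g h : CircleDeg1Liftˣ) (x : ℝ) : (g * h) x = g (h x) := rfl

lemma lift_coe_periodic (g : CircleDeg1Liftˣ) :
    Function.Periodic (fun t : ℝ => ((g t : ℝ) : Circ)) 1 := fun t => by
  have : (g (t + 1) : ℝ) = g t + 1 := CircleDeg1Lift.map_add_one _ _
  simp only [this]
  exact AddCircle.coe_add_period 1 _

/-- The map of the circle induced by an invertible degree one lift. -/
noncomputable def circleMap (g : CircleDeg1Liftˣ) : Circ → Circ := (lift_coe_periodic g).lift

lemma circleMap_mul (g h : CircleDeg1Liftˣ) (x : Circ) :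
    circleMap (g * h) x = circleMap g (circleMap h x) := by
  induction x using QuotientAddGroup.induction_on with
  | H t => rfl

lemma circleMap_one (x : Circ) : circleMap 1 x = x := by
  induction x using QuotientAddGroup.induction_on with
  | H t => rfl

lemma circleMap_continuous (g : CircleDeg1Liftˣ) : Continuous (circleMap g) :=
  continuous_quot_lift _ ((AddCircle.continuous_mk' 1).comp (lift_continuous g))

/-- The homomorphism that sends an invertible degree one lift to the homeomorphism of the circle
that it induces. -/
noncomputable def circleHomeo : CircleDeg1Liftˣ →* (Circ ≃ₜ Circ) where
  toFun g :=
    { toFun := circleMap g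
      invFun := circleMap g⁻¹
      left_inv := fun x => by rw [← circleMap_mul, inv_mul_cancel, circleMap_one]
      right_inv := fun x => by rw [← circleMap_mul, mul_inv_cancel, circleMap_one]
      continuous_toFun := circleMap_continuous g
      continuous_invFun := circleMap_continuous g⁻¹ }
  map_one' := Homeomorph.ext circleMap_one
  map_mul' g h := Homeomorph.ext (circleMap_mul g h)

lemma circleHomeo_coe (g : CircleDeg1Liftˣ) (t : ℝ) :
    circleHomeo g (t : Circ) = ((g t : ℝ) : Circ) := rfl

lemma coe_eq_coe_iff {s t : ℝ} : (s : Circ) = (t : Circ) ↔ ∃ q : ℤ, t = s + q := by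
  rw [eq_comm, ← sub_eq_zero, ← AddCircle.coe_sub, AddCircle.coe_eq_zero_iff]
  constructor
  · rintro ⟨q, hq⟩
    exact ⟨q, by rw [zsmul_eq_mul, mul_one] at hq; linarith⟩
  · rintro ⟨q, hq⟩
    exact ⟨q, by rw [zsmul_eq_mul, mul_one]; linarith⟩

/-! ### The generators -/

/-- The piecewise linear homeomorphism of `ℝ` with support `(0, 2)` that is linear of slope `3` on
`[0, 1/2]` and of slope `1/3` on `[1/2, 2]`. -/
noncomputable def bump (t : ℝ) : ℝ := max t (min (3 * t) ((4 + t) / 3))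

/-- The inverse of `bump`. -/
noncomputable def bumpInv (t : ℝ) : ℝ := min t (max (t / 3) (3 * t - 4))

lemma bump_mono : Monotone bump := fun s t h => by
  unfold bump
  gcongr

lemma bumpInv_mono : Monotone bumpInv := fun s t h => by
  unfold bumpInv
  gcongr

lemma bump_left {t : ℝ} (h0 : 0 ≤ t) (h1 : t ≤ 1 / 2) : bump t = 3 * t := by
  rw [bump, min_eq_left (by linarith), max_eq_right (by linarith)]

lemma bump_right {t : ℝ} (h0 : 1 / 2 ≤ t) (h1 : t ≤ 2) : bump t = (4 + t) / 3 := by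
  rw [bump, min_eq_right (by linarith), max_eq_right (by linarith)]

lemma bump_of_two_le {t : ℝ} (h : 2 ≤ t) : bump t = t := by
  rw [bump, max_eq_left]
  exact min_le_of_right_le (by linarith)

lemma bumpInv_bump {t : ℝ} (h : 0 ≤ t) : bumpInv (bump t) = t := by
  rcases le_total t (1 / 2) with h1 | h1
  · rw [bump_left h h1, bumpInv, max_eq_left (by linarith), min_eq_right (by linarith)]
    ring
  rcases le_total t 2 with h2 | h2
  · rw [bump_right h1 h2, bumpInv, max_eq_right (by linarith), min_eq_right (by linarith)]
    ring
  · rw [bump_of_two_le h2, bumpInv, min_eq_left]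
    exact le_max_of_le_right (by linarith)

lemma bump_bumpInv {t : ℝ} (h : 0 ≤ t) : bump (bumpInv t) = t := by
  rcases le_total t (3 / 2) with h1 | h1
  · rw [bumpInv, max_eq_left (by linarith), min_eq_right (by linarith),
      bump_left (by linarith) (by linarith)]
    ring
  rcases le_total t 2 with h2 | h2
  · rw [bumpInv, max_eq_right (by linarith), min_eq_right (by linarith),
      bump_right (by linarith) (by linarith)]
    ring
  · rw [bumpInv, min_eq_left (le_max_of_le_right (by linarith)), bump_of_two_le h2]

/-- The degree one lift that equals `t ↦ φ (n * t) / n` on `[0, 1)`. -/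
noncomputable def periodize (n : ℕ) (φ : ℝ → ℝ) (hn : 0 < n) (hφ : Monotone φ)
    (h0 : φ 0 = 0) (hφn : φ n = n) : CircleDeg1Lift where
  toFun x := ⌊x⌋ + φ (n * Int.fract x) / n
  monotone' x y hxy := by
    have hn' : (0 : ℝ) < n := Nat.cast_pos.2 hn
    rcases (Int.floor_mono hxy).eq_or_lt with h | h
    · have : Int.fract x ≤ Int.fract y := by
        unfold Int.fract
        rw [h]
        linarith
      have := hφ (mul_le_mul_of_nonneg_left this hn'.le)
      dsimp only
      rw [h]
      gcongr
    · have h1 : φ (n * Int.fract x) / n ≤ 1 := by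
        rw [div_le_one hn']
        exact (hφ (mul_le_of_le_one_right hn'.le (Int.fract_lt_one x).le)).trans hφn.le
      have h2 : 0 ≤ φ (n * Int.fract y) / n := by
        refine div_nonneg ?_ hn'.le
        rw [← h0]
        exact hφ (mul_nonneg hn'.le (Int.fract_nonneg y))
      have h3 : (⌊x⌋ : ℝ) + 1 ≤ ⌊y⌋ := by exact_mod_cast h
      dsimp only
      linarith
  map_add_one' x := by
    rw [Int.floor_add_one, Int.fract_add_one]
    push_cast
    ring

lemma periodize_apply {n : ℕ} {φ : ℝ → ℝ} {hn : 0 < n} {hφ : Monotone φ}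
    {h0 : φ 0 = 0} {hφn : φ n = n} (x : ℝ) :
    periodize n φ hn hφ h0 hφn x = ⌊x⌋ + φ (n * Int.fract x) / n := rfl

lemma periodize_periodize {n : ℕ} {φ ψ : ℝ → ℝ} {hn : 0 < n} {hφ : Monotone φ}
    {h0 : φ 0 = 0} {hφn : φ n = n} {hψ : Monotone ψ} {h0' : ψ 0 = 0} {hψn : ψ n = n}
    (h : ∀ t, 0 ≤ t → ψ (φ t) = t) (x : ℝ) :
    periodize n ψ hn hψ h0' hψn (periodize n φ hn hφ h0 hφn x) = x := by
  have hn' : (0 : ℝ) < n := Nat.cast_pos.2 hn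
  have ht0 : 0 ≤ n * Int.fract x := mul_nonneg hn'.le (Int.fract_nonneg x)
  have htn : n * Int.fract x < n := mul_lt_of_lt_one_right hn' (Int.fract_lt_one x)
  have h1 : 0 ≤ φ (n * Int.fract x) := h0 ▸ hφ ht0
  have h2 : φ (n * Int.fract x) < n := by
    refine lt_of_le_of_ne ((hφ htn.le).trans hφn.le) fun he => ?_
    have := h _ ht0
    rw [he, hψn] at this
    linarith
  have h3 : ⌊φ (n * Int.fract x) / n⌋ = 0 := by
    rw [Int.floor_eq_zero_iff]
    exact ⟨div_nonneg h1 hn'.le, (div_lt_one hn').2 h2⟩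
  have h4 : Int.fract (φ (n * Int.fract x) / n) = φ (n * Int.fract x) / n := by
    rw [Int.fract, h3]
    simp
  rw [periodize_apply, periodize_apply, Int.floor_intCast_add, Int.fract_intCast_add, h3, h4,
    mul_div_cancel₀ _ hn'.ne', h _ ht0, mul_div_cancel_left₀ _ hn'.ne']
  push_cast
  rw [add_zero, Int.floor_add_fract]

/-- The lift to `ℝ` of the generator with index `0`: the periodization of `bump`, rescaled so that
the period is `1`. -/
noncomputable def genZero (n : ℕ) (hn : 3 ≤ n) : CircleDeg1Liftˣ :=
  have hn' : (3 : ℝ) ≤ n := by exact_mod_cast hn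
  have h0 : bump 0 = 0 := by rw [bump_left le_rfl (by norm_num)]; norm_num
  have hb : bump n = n := bump_of_two_le (by linarith)
  have h0' : bumpInv 0 = 0 := by rw [← h0, bumpInv_bump le_rfl, h0]
  have hb' : bumpInv n = n := by rw [← hb, bumpInv_bump (by linarith), hb]
  { val := periodize n bump (by omega) bump_mono h0 hb
    inv := periodize n bumpInv (by omega) bumpInv_mono h0' hb'
    val_inv := CircleDeg1Lift.ext (periodize_periodize (hψ := bump_mono) (h0' := h0) (hψn := hb)
      fun _ => bump_bumpInv)
    inv_val := CircleDeg1Lift.ext (periodize_periodize (hψ := bumpInv_mono) (h0' := h0')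
      (hψn := hb') fun _ => bumpInv_bump) }

/-- The lift to `ℝ` of the generator with index `k`, for any integer `k`. It depends only on `k`
modulo `n`. -/
noncomputable def gen (n : ℕ) (hn : 3 ≤ n) (k : ℤ) : CircleDeg1Liftˣ :=
  CircleDeg1Lift.translate (Multiplicative.ofAdd (k / n : ℝ)) * genZero n hn *
    (CircleDeg1Lift.translate (Multiplicative.ofAdd (k / n : ℝ)))⁻¹

lemma gen_apply {n : ℕ} (hn : 3 ≤ n) (k : ℤ) (x : ℝ) :
    gen n hn k x = k / n + (⌊-(k / n) + x⌋ + bump (n * Int.fract (-(k / n) + x)) / n) := by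
  rw [gen, mul_lift_apply, mul_lift_apply, CircleDeg1Lift.translate_inv_apply,
    CircleDeg1Lift.translate_apply]
  rfl

lemma gen_add_mul {n : ℕ} (hn : 3 ≤ n) (k q : ℤ) : gen n hn (k + n * q) = gen n hn k := by
  have hn' : (n : ℝ) ≠ 0 := by positivity
  refine Units.ext (CircleDeg1Lift.ext fun x => ?_)
  rw [gen_apply, gen_apply]
  have : -(((k + n * q : ℤ) : ℝ) / n) + x = -(k / n) + x - (q : ℤ) := by
    push_cast
    field_simp
    ring
  rw [this, Int.floor_sub_intCast, Int.fract_sub_intCast]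
  push_cast
  field_simp
  ring

/-- The action of lifts in the coordinate `y = n * x`, in which the endpoints of the intervals of
the ring are the integers and the circle is `ℝ / nℤ`. -/
noncomputable def act (n : ℕ) (g : CircleDeg1Liftˣ) (y : ℝ) : ℝ := n * g (y / n)

variable {n : ℕ}

lemma act_mul (hn : 3 ≤ n) (g h : CircleDeg1Liftˣ) (y : ℝ) :
    act n (g * h) y = act n g (act n h y) := by
  have hn' : (n : ℝ) ≠ 0 := by positivity
  rw [act, act, act, mul_lift_apply, mul_div_cancel_left₀ _ hn']

lemma act_one (hn : 3 ≤ n) (y : ℝ) : act n 1 y = y := by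
  have hn' : (n : ℝ) ≠ 0 := by positivity
  exact mul_div_cancel₀ y hn'

lemma act_inv_act (hn : 3 ≤ n) (g : CircleDeg1Liftˣ) (y : ℝ) : act n g⁻¹ (act n g y) = y := by
  rw [← act_mul hn, inv_mul_cancel, act_one hn]

lemma act_act_inv (hn : 3 ≤ n) (g : CircleDeg1Liftˣ) (y : ℝ) : act n g (act n g⁻¹ y) = y := by
  rw [← act_mul hn, mul_inv_cancel, act_one hn]

lemma act_strictMono (hn : 3 ≤ n) (g : CircleDeg1Liftˣ) : StrictMono (act n g) := by
  have hn' : (0 : ℝ) < n := by positivity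
  exact fun x y h => mul_lt_mul_of_pos_left (lift_strictMono g (div_lt_div_of_pos_right h hn')) hn'

lemma act_add_mul (hn : 3 ≤ n) (g : CircleDeg1Liftˣ) (y : ℝ) (q : ℤ) :
    act n g (y + n * q) = act n g y + n * q := by
  have hn' : (n : ℝ) ≠ 0 := by positivity
  have : g (y / n + q) = g (y / n) + q := CircleDeg1Lift.map_add_int _ _ _
  rw [act, act, add_div, mul_div_cancel_left₀ _ hn', this, mul_add]

lemma act_gen (hn : 3 ≤ n) {k : ℤ} {y : ℝ} (h1 : k ≤ y) (h2 : y < k + n) :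
    act n (gen n hn k) y = k + bump (y - k) := by
  have hn' : (0 : ℝ) < n := by positivity
  have e : -((k : ℝ) / n) + y / n = (y - k) / n := by ring
  have hfl : ⌊(y - k) / n⌋ = 0 := by
    rw [Int.floor_eq_zero_iff]
    exact ⟨div_nonneg (by linarith) hn'.le, (div_lt_one hn').2 (by linarith)⟩
  rw [act, gen_apply, e, Int.fract, hfl, Int.cast_zero, sub_zero, mul_div_cancel₀ _ hn'.ne']
  field_simp
  ring

lemma act_gen_left (hn : 3 ≤ n) {k : ℤ} {y : ℝ} (h1 : k ≤ y) (h2 : y ≤ k + 1 / 2) :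
    act n (gen n hn k) y = k + 3 * (y - k) := by
  have hn' : (3 : ℝ) ≤ n := by exact_mod_cast hn
  rw [act_gen hn h1 (by linarith), bump_left (by linarith) (by linarith)]

lemma act_gen_right (hn : 3 ≤ n) {k : ℤ} {y : ℝ} (h1 : k + 1 / 2 ≤ y) (h2 : y ≤ k + 2) :
    act n (gen n hn k) y = k + (4 + (y - k)) / 3 := by
  have hn' : (3 : ℝ) ≤ n := by exact_mod_cast hn
  rw [act_gen hn (by linarith) (by linarith), bump_right (by linarith) (by linarith)]

lemma act_gen_fix (hn : 3 ≤ n) {k : ℤ} {y : ℝ} (h1 : k + 2 ≤ y) (h2 : y ≤ k + n) :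
    act n (gen n hn k) y = y := by
  rcases h2.lt_or_eq with h | rfl
  · rw [act_gen hn (by linarith) h, bump_of_two_le (by linarith)]
    ring
  · have h := act_add_mul hn (gen n hn k) k 1
    rw [act_gen_left hn le_rfl (by linarith)] at h
    simpa using h

lemma act_gen_self (hn : 3 ≤ n) (k : ℤ) : act n (gen n hn k) k = k := by
  rw [act_gen_left hn le_rfl (by linarith)]
  ring

lemma act_gen_add_two (hn : 3 ≤ n) (k : ℤ) : act n (gen n hn k) (k + 2) = k + 2 := by
  rw [act_gen_right hn (by linarith) le_rfl]
  ring

lemma act_gen_half (hn : 3 ≤ n) (k : ℤ) : act n (gen n hn k) (k + 1 / 2) = k + 1 + 1 / 2 := by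
  rw [act_gen_left hn (by linarith) le_rfl]
  ring

lemma add_min_le_act_gen (hn : 3 ≤ n) {k : ℤ} {y : ℝ} (h1 : k ≤ y) (h2 : y ≤ k + 2) :
    y + 2 / 3 * min (y - k) (k + 2 - y) ≤ act n (gen n hn k) y := by
  rcases le_total y (k + 1 / 2) with h | h
  · rw [act_gen_left hn h1 h]
    linarith [min_le_left (y - k) (k + 2 - y)]
  · rw [act_gen_right hn h h2]
    linarith [min_le_right (y - k) (k + 2 - y)]

lemma lt_act_gen (hn : 3 ≤ n) {k : ℤ} {y : ℝ} (h1 : k < y) (h2 : y < k + 2) :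
    y < act n (gen n hn k) y := by
  have := add_min_le_act_gen hn h1.le h2.le
  have : 0 < min (y - k) (k + 2 - y) := lt_min (by linarith) (by linarith)
  linarith

lemma act_gen_lt (hn : 3 ≤ n) {k : ℤ} {y : ℝ} (h : y < k + 2) :
    act n (gen n hn k) y < k + 2 := by
  rw [← act_gen_add_two hn k]
  exact act_strictMono hn _ h

lemma act_pow_fix (hn : 3 ≤ n) {g : CircleDeg1Liftˣ} {y : ℝ} (h : act n g y = y) (m : ℕ) :
    act n (g ^ m) y = y := by
  induction m with
  | zero => rw [pow_zero, act_one hn]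
  | succ m ih => rw [pow_succ, act_mul hn, h, ih]

/-- Powers of a generator push the points of its support towards the right endpoint. -/
lemma exists_le_act_gen_pow (hn : 3 ≤ n) {k : ℤ} {y z : ℝ} (h1 : k < y) (h2 : y < k + 2)
    (hz : z < k + 2) : ∃ m : ℕ, z ≤ act n (gen n hn k ^ m) y := by
  set δ := 2 / 3 * min (y - k) (k + 2 - z) with hδ
  have hδ0 : 0 < δ := by
    have : 0 < min (y - k) (k + 2 - z) := lt_min (by linarith) (by linarith)
    positivity
  have key : ∀ m : ℕ, min z (y + m * δ) ≤ act n (gen n hn k ^ m) y ∧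
      y ≤ act n (gen n hn k ^ m) y ∧ act n (gen n hn k ^ m) y < k + 2 := by
    intro m
    induction m with
    | zero => simp [act_one hn, h2]
    | succ m ih =>
      obtain ⟨ih1, ih2, ih3⟩ := ih
      rw [pow_succ', act_mul hn]
      set w := act n (gen n hn k ^ m) y
      have hw := lt_act_gen hn (h1.trans_le ih2) ih3
      refine ⟨?_, ih2.trans hw.le, act_gen_lt hn ih3⟩
      rcases le_total z w with h | h
      · exact (min_le_left _ _).trans (h.trans hw.le)
      · have h3 := add_min_le_act_gen hn (h1.le.trans ih2) ih3.le
        have h4 : min (y - k) (k + 2 - z) ≤ min (w - k) (k + 2 - w) :=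
          min_le_min (by linarith) (by linarith)
        have h5 : w + δ ≤ act n (gen n hn k) w := by
          rw [hδ]
          linarith
        refine le_trans ?_ h5
        rcases min_le_iff.1 ih1 with h6 | h6
        · exact (min_le_left _ _).trans (by linarith)
        · refine (min_le_right _ _).trans ?_
          push_cast
          linarith
  obtain ⟨m, hm⟩ := exists_nat_gt ((z - y) / δ)
  refine ⟨m, ?_⟩
  rw [div_lt_iff₀ hδ0] at hm
  have := (key m).1
  rwa [min_eq_left (by linarith)] at this

/-- The group of lifts generated by the lifts of the generators. -/
noncomputable def liftGroup (n : ℕ) (hn : 3 ≤ n) : Subgroup CircleDeg1Liftˣ :=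
  Subgroup.closure (Set.range (gen n hn))

lemma gen_mem (hn : 3 ≤ n) (k : ℤ) : gen n hn k ∈ liftGroup n hn :=
  Subgroup.subset_closure ⟨k, rfl⟩

/-! ### Expansion: every interval is moved onto an endpoint -/

lemma act_gen_inv (hn : 3 ≤ n) {k : ℤ} {y : ℝ} (h1 : k + 1 / 2 ≤ y) (h2 : y ≤ k + 1) :
    act n (gen n hn (k - 1))⁻¹ y = 3 * y - 2 * k - 2 := by
  have h : act n (gen n hn (k - 1)) (3 * y - 2 * k - 2) = y := by
    rw [act_gen_right hn (by push_cast; linarith) (by push_cast; linarith)]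
    push_cast
    ring
  conv_lhs => rw [← h]
  exact act_inv_act hn _ _

/-- An interval with right endpoint `k + 1 / 2` grows by the factor `3` under the generator with
index `k`, and its right endpoint moves to `k + 1 + 1 / 2`. -/
lemma exists_act_lt_int_lt_half (hn : 3 ≤ n) (m : ℕ) : ∀ (k : ℤ) (a : ℝ), a < k + 1 / 2 →
    1 / 2 < 3 ^ m * (k + 1 / 2 - a) →
      ∃ g ∈ liftGroup n hn, ∃ j : ℤ, act n g a < j ∧ j < act n g (k + 1 / 2) := by
  induction m with
  | zero =>
    intro k a _ h
    refine ⟨1, one_mem _, k, ?_, ?_⟩ <;> rw [act_one hn] <;> linarith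
  | succ m ih =>
    intro k a ha h
    rcases lt_or_ge a k with hak | hak
    · refine ⟨1, one_mem _, k, ?_, ?_⟩ <;> rw [act_one hn] <;> linarith
    · have e := act_gen_left hn hak ha.le
      obtain ⟨g, hg, j, h1, h2⟩ := ih (k + 1) (act n (gen n hn k) a)
        (by rw [e]; push_cast; linarith)
        (by
          rw [e]
          push_cast
          rw [pow_succ] at h
          linarith)
      refine ⟨g * gen n hn k, mul_mem hg (gen_mem hn k), j, ?_, ?_⟩
      · rwa [act_mul hn]
      · rw [act_mul hn, act_gen_half]
        exact_mod_cast h2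

/-- On each of the intervals `[k, k + 1 / 2]` and `[k + 1 / 2, k + 1]` some generator or its
inverse expands by the factor `3`, so that every interval eventually contains an integer. -/
lemma exists_act_lt_int_lt_of_pow (hn : 3 ≤ n) (m : ℕ) : ∀ a b : ℝ, a < b →
    1 / 2 < 3 ^ m * (b - a) →
      ∃ g ∈ liftGroup n hn, ∃ j : ℤ, act n g a < j ∧ j < act n g b := by
  induction m with
  | zero =>
    intro a b hab h
    have h1 := Int.floor_le a
    have h2 := Int.lt_floor_add_one a
    rcases lt_or_ge ((⌊a⌋ : ℝ) + 1) b with hb | hb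
    · refine ⟨1, one_mem _, ⌊a⌋ + 1, ?_, ?_⟩ <;> rw [act_one hn] <;> push_cast <;> linarith
    · obtain ⟨m', hm'⟩ := pow_unbounded_of_one_lt ((1 / 2) / (⌊a⌋ + 1 / 2 - a))
        (by norm_num : (1 : ℝ) < 3)
      have ha : a < ⌊a⌋ + 1 / 2 := by linarith
      rw [div_lt_iff₀ (by linarith)] at hm'
      obtain ⟨g, hg, j, h3, h4⟩ := exists_act_lt_int_lt_half hn m' ⌊a⌋ a ha hm'
      exact ⟨g, hg, j, h3, h4.trans (act_strictMono hn g (by linarith))⟩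
  | succ m ih =>
    intro a b hab h
    rw [pow_succ] at h
    have h1 := Int.floor_le a
    have h2 := Int.lt_floor_add_one a
    rcases lt_or_ge ((⌊a⌋ : ℝ) + 1) b with hb | hb
    · refine ⟨1, one_mem _, ⌊a⌋ + 1, ?_, ?_⟩ <;> rw [act_one hn] <;> push_cast <;> linarith
    rcases le_or_gt b (⌊a⌋ + 1 / 2) with hb' | hb'
    · have ea := act_gen_left hn h1 (by linarith)
      have eb := act_gen_left hn (h1.trans hab.le) hb'
      obtain ⟨g, hg, j, h3, h4⟩ := ih (act n (gen n hn ⌊a⌋) a) (act n (gen n hn ⌊a⌋) b)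
        (act_strictMono hn _ hab) (by rw [ea, eb]; linarith)
      exact ⟨g * gen n hn ⌊a⌋, mul_mem hg (gen_mem hn _), j, by rwa [act_mul hn],
        by rwa [act_mul hn]⟩
    rcases le_or_gt ((⌊a⌋ : ℝ) + 1 / 2) a with ha' | ha'
    · have ea := act_gen_inv hn ha' (by linarith)
      have eb := act_gen_inv hn hb'.le hb
      obtain ⟨g, hg, j, h3, h4⟩ := ih (act n (gen n hn (⌊a⌋ - 1))⁻¹ a)
        (act n (gen n hn (⌊a⌋ - 1))⁻¹ b)
        (act_strictMono hn _ hab) (by rw [ea, eb]; linarith)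
      exact ⟨g * (gen n hn (⌊a⌋ - 1))⁻¹, mul_mem hg (inv_mem (gen_mem hn _)), j,
        by rwa [act_mul hn], by rwa [act_mul hn]⟩
    · obtain ⟨m', hm'⟩ := pow_unbounded_of_one_lt ((1 / 2) / (⌊a⌋ + 1 / 2 - a))
        (by norm_num : (1 : ℝ) < 3)
      rw [div_lt_iff₀ (by linarith)] at hm'
      obtain ⟨g, hg, j, h3, h4⟩ := exists_act_lt_int_lt_half hn m' ⌊a⌋ a ha' hm'
      exact ⟨g, hg, j, h3, h4.trans (act_strictMono hn g hb')⟩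

lemma exists_act_lt_int_lt (hn : 3 ≤ n) {a b : ℝ} (hab : a < b) :
    ∃ g ∈ liftGroup n hn, ∃ j : ℤ, act n g a < j ∧ j < act n g b := by
  obtain ⟨m, hm⟩ := pow_unbounded_of_one_lt ((1 / 2) / (b - a)) (by norm_num : (1 : ℝ) < 3)
  rw [div_lt_iff₀ (by linarith)] at hm
  exact exists_act_lt_int_lt_of_pow hn m a b hab hm

lemma exists_act_lt_add_one_lt (hn : 3 ≤ n) {a b : ℝ} {k : ℤ} (ha : a < k) (hb : k < b) :
    ∃ g ∈ liftGroup n hn, act n g a < k + 1 ∧ k + 1 < act n g b := by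
  obtain ⟨m, hm⟩ := exists_le_act_gen_pow hn (k := k) (y := min b (k + 1)) (z := k + 3 / 2)
    (lt_min hb (by linarith)) ((min_le_right _ _).trans_lt (by linarith)) (by linarith)
  refine ⟨gen n hn k ^ m, pow_mem (gen_mem hn k) m, ?_, ?_⟩
  · have h := act_strictMono hn (gen n hn k ^ m) ha
    rw [act_pow_fix hn (act_gen_self hn k)] at h
    linarith
  · have h := (act_strictMono hn (gen n hn k ^ m)).monotone (min_le_left b (k + 1))
    linarith

lemma exists_act_lt_add_nat_lt (hn : 3 ≤ n) {a b : ℝ} {k : ℤ} (ha : a < k) (hb : k < b) (j : ℕ) :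
    ∃ g ∈ liftGroup n hn, act n g a < ((k + j : ℤ) : ℝ) ∧ ((k + j : ℤ) : ℝ) < act n g b := by
  induction j with
  | zero => exact ⟨1, one_mem _, by simpa [act_one hn] using ha, by simpa [act_one hn] using hb⟩
  | succ j ih =>
    obtain ⟨g, hg, h1, h2⟩ := ih
    obtain ⟨h, hh, h3, h4⟩ := exists_act_lt_add_one_lt hn h1 h2
    refine ⟨h * g, mul_mem hh hg, ?_, ?_⟩ <;> rw [act_mul hn] <;> push_cast at h3 h4 ⊢ <;> linarith

lemma exists_act_lt_mul_lt (hn : 3 ≤ n) {a b : ℝ} (hab : a < b) :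
    ∃ g ∈ liftGroup n hn, ∃ q : ℤ, act n g a < n * q ∧ n * q < act n g b := by
  obtain ⟨g, hg, k, h1, h2⟩ := exists_act_lt_int_lt hn hab
  have hk : 0 ≤ n * |k| - k := by
    have : 1 * |k| ≤ n * |k| := by gcongr; omega
    linarith [le_abs_self k]
  obtain ⟨h, hh, h3, h4⟩ := exists_act_lt_add_nat_lt hn h1 h2 (n * |k| - k).toNat
  have e : k + ((n * |k| - k).toNat : ℤ) = n * |k| := by
    rw [Int.toNat_of_nonneg hk]
    ring
  rw [e] at h3 h4
  refine ⟨h * g, mul_mem hh hg, |k|, ?_, ?_⟩ <;> rw [act_mul hn]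
  · exact_mod_cast h3
  · exact_mod_cast h4

/-! ### Contraction: the complement of a neighbourhood of an endpoint becomes small -/

/-- If `u < 0` is close to `0` and `0 < v`, then the generators with indices `0, …, n - 3` fix `u`
and can be used to push `v` beyond `n - 2`. -/
lemma exists_act_eq_lt_act (hn : 3 ≤ n) {u v : ℝ} (hu : -(1 / 2) ≤ u) (hu' : u < 0) (hv : 0 < v)
    (j : ℕ) (hj : j + 2 ≤ n) : ∃ g ∈ liftGroup n hn, act n g u = u ∧ j < act n g v := by
  induction j with
  | zero => exact ⟨1, one_mem _, act_one hn u, by simpa [act_one hn] using hv⟩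
  | succ j ih =>
    obtain ⟨g, hg, h1, h2⟩ := ih (by omega)
    have hj' : (j : ℝ) + 3 ≤ n := by exact_mod_cast (show j + 3 ≤ n by omega)
    have hu0 : act n (gen n hn j) u = u := by
      have h := act_gen_fix hn (k := (j : ℤ)) (y := u + n) (by push_cast; linarith)
        (by push_cast; linarith [(Nat.cast_nonneg j : (0 : ℝ) ≤ j)])
      have h' := act_add_mul hn (gen n hn j) u 1
      rw [Int.cast_one, mul_one, h] at h'
      linarith
    obtain ⟨m, hm⟩ := exists_le_act_gen_pow hn (k := (j : ℤ)) (y := min (act n g v) (j + 1))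
      (z := j + 3 / 2) (lt_min (by exact_mod_cast h2) (by push_cast; linarith))
      ((min_le_right _ _).trans_lt (by push_cast; linarith)) (by push_cast; linarith)
    refine ⟨gen n hn j ^ m * g, mul_mem (pow_mem (gen_mem hn _) m) hg, ?_, ?_⟩
    · rw [act_mul hn, h1, act_pow_fix hn hu0]
    · have h := (act_strictMono hn (gen n hn j ^ m)).monotone (min_le_left (act n g v) (j + 1))
      rw [act_mul hn]
      push_cast
      linarith

lemma exists_act_nonpos_le_act (hn : 3 ≤ n) {u v ε : ℝ} (hu : u < 0) (hv : 0 < v) (hε : 0 < ε) :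
    ∃ g ∈ liftGroup n hn, act n g u ≤ 0 ∧ n - ε ≤ act n g v := by
  have hu' : max u (-(1 / 2)) < 0 := max_lt hu (by norm_num)
  obtain ⟨g, hg, h1, h2⟩ := exists_act_eq_lt_act hn (le_max_right u _) hu' hv (n - 2) (by omega)
  have hc : ((n - 2 : ℕ) : ℝ) = n - 2 := by
    rw [Nat.cast_sub (by omega)]
    norm_num
  rw [hc] at h2
  -- The support of the generator with index `n - 2` contains both `u + n` and the image of `v`.
  obtain ⟨m, hm⟩ := exists_le_act_gen_pow hn (k := (n - 2 : ℤ)) (y := min (act n g v) (n - 1))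
    (z := n - ε) (lt_min (by push_cast; linarith) (by push_cast; linarith))
    ((min_le_right _ _).trans_lt (by push_cast; linarith)) (by push_cast; linarith)
  refine ⟨gen n hn (n - 2) ^ m * g, mul_mem (pow_mem (gen_mem hn _) m) hg, ?_, ?_⟩
  · have hfix : act n (gen n hn (n - 2) ^ m) 0 = 0 := by
      refine act_pow_fix hn ?_ m
      have h := act_gen_add_two hn (n - 2 : ℤ)
      have h' := act_add_mul hn (gen n hn (n - 2)) 0 1
      push_cast at h h'
      rw [show (n : ℝ) - 2 + 2 = 0 + n * 1 by ring, h'] at h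
      linarith
    refine ((act_strictMono hn _).monotone (le_max_left u (-(1 / 2)))).trans ?_
    rw [act_mul hn, h1]
    conv_rhs => rw [← hfix]
    exact (act_strictMono hn _).monotone hu'.le
  · rw [act_mul hn]
    exact hm.trans ((act_strictMono hn _).monotone (min_le_left _ _))

/-! ### No translations in the group of lifts -/

/-- The expanding map of slope `3` that equals the generator with index `k` on `[k, k + 1 / 2)` and
the inverse of the generator with index `k - 1` on `[k + 1 / 2, k + 1)`. -/
noncomputable def expand (y : ℝ) : ℝ :=
  if y < ⌊y⌋ + 1 / 2 then ⌊y⌋ + 3 * (y - ⌊y⌋) else 3 * y - 2 * ⌊y⌋ - 2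

/-- The points whose orbit under the expanding map ends in `0`. -/
def zeroBasin : Set ℝ := {y | ∃ m : ℕ, expand^[m] y = 0}

lemma expand_intCast (k : ℤ) : expand k = k := by
  rw [expand, Int.floor_intCast, if_pos (by linarith)]
  ring

lemma expand_mem_zeroBasin {y : ℝ} : expand y ∈ zeroBasin ↔ y ∈ zeroBasin := by
  constructor
  · rintro ⟨m, hm⟩
    exact ⟨m + 1, hm⟩
  · rintro ⟨m | m, hm⟩
    · refine ⟨0, ?_⟩
      have h0 : y = 0 := hm
      have := expand_intCast 0
      rw [h0]
      simpa using this
    · exact ⟨m, hm⟩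

lemma intCast_mem_zeroBasin {k : ℤ} (h : (k : ℝ) ∈ zeroBasin) : k = 0 := by
  obtain ⟨m, hm⟩ := h
  rw [Function.iterate_fixed (expand_intCast k)] at hm
  exact_mod_cast hm

lemma act_gen_mem_zeroBasin (hn : 3 ≤ n) (k : ℤ) (y : ℝ) :
    act n (gen n hn k) y ∈ zeroBasin ↔ y ∈ zeroBasin := by
  -- Replace `k` by the congruent index for which `k ≤ y ≤ k + n`.
  have hn' : (0 : ℝ) < n := by positivity
  obtain ⟨k', hgen, h1, h2⟩ : ∃ k' : ℤ, gen n hn k = gen n hn k' ∧ k' ≤ y ∧ y ≤ k' + n := by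
    refine ⟨k + n * ⌊(y - k) / n⌋, (gen_add_mul hn _ _).symm, ?_, ?_⟩
    · have := Int.floor_le ((y - k) / n)
      rw [le_div_iff₀ hn'] at this
      push_cast
      linarith
    · have := Int.lt_floor_add_one ((y - k) / n)
      rw [div_lt_iff₀ hn'] at this
      push_cast
      linarith
  rw [hgen]
  rcases lt_or_ge y (k' + 1 / 2) with h3 | h3
  · have hfl : ⌊y⌋ = k' := Int.floor_eq_iff.2 ⟨h1, by linarith⟩
    have : act n (gen n hn k') y = expand y := by
      rw [act_gen_left hn h1 h3.le, expand, hfl, if_pos h3]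
    rw [this, expand_mem_zeroBasin]
  rcases lt_or_ge y (k' + 2) with h4 | h4
  · have e := act_gen_right hn h3 h4.le
    have hfl : ⌊act n (gen n hn k') y⌋ = k' + 1 := by
      rw [Int.floor_eq_iff, e]
      push_cast
      exact ⟨by linarith, by linarith⟩
    have : expand (act n (gen n hn k') y) = y := by
      rw [expand, hfl, e, if_neg]
      · push_cast
        ring
      · push_cast
        linarith
    rw [← expand_mem_zeroBasin, this]
  · rw [act_gen_fix hn h4 h2]

lemma act_mem_zeroBasin (hn : 3 ≤ n) {g : CircleDeg1Liftˣ} (hg : g ∈ liftGroup n hn) :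
    ∀ y, act n g y ∈ zeroBasin ↔ y ∈ zeroBasin := by
  induction hg using Subgroup.closure_induction with
  | mem g hg => obtain ⟨k, rfl⟩ := hg; exact act_gen_mem_zeroBasin hn k
  | one => exact fun y => by rw [act_one hn]
  | mul g h _ _ ihg ihh => exact fun y => by rw [act_mul hn, ihg, ihh]
  | inv g _ ih => exact fun y => by rw [← ih, act_act_inv hn]

/-- The point of the circle with coordinate `y`, in the normalization where the circle has
length `n`. -/
noncomputable def pt (n : ℕ) (y : ℝ) : Circ := ((y / n : ℝ) : Circ)

lemma circleHomeo_pt (hn : 3 ≤ n) (g : CircleDeg1Liftˣ) (y : ℝ) :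
    circleHomeo g (pt n y) = pt n (act n g y) := by
  have hn' : (n : ℝ) ≠ 0 := by positivity
  rw [pt, circleHomeo_coe, pt, act, mul_div_cancel_left₀ _ hn']

lemma pt_eq_pt_iff (hn : 3 ≤ n) {y z : ℝ} : pt n y = pt n z ↔ ∃ q : ℤ, z = y + n * q := by
  have hn' : (n : ℝ) ≠ 0 := by positivity
  rw [pt, pt, coe_eq_coe_iff]
  refine exists_congr fun q => ?_
  rw [div_add' _ _ _ hn', div_left_inj' hn', mul_comm]

lemma exists_pt_eq (hn : 3 ≤ n) (x : Circ) : ∃ y, pt n y = x := by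
  have hn' : (n : ℝ) ≠ 0 := by positivity
  induction x using QuotientAddGroup.induction_on with
  | H t => exact ⟨n * t, by rw [pt, mul_div_cancel_left₀ _ hn']⟩

lemma exists_pt_eq_mem_Ico (hn : 3 ≤ n) (c : ℝ) (x : Circ) : ∃ y ∈ Ico c (c + n), pt n y = x := by
  obtain ⟨y, rfl⟩ := exists_pt_eq hn x
  have hn' : (0 : ℝ) < n := by positivity
  obtain ⟨q, hq, -⟩ := existsUnique_add_zsmul_mem_Ico hn' y c
  refine ⟨_, hq, ?_⟩
  rw [eq_comm, pt_eq_pt_iff hn]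
  exact ⟨q, by rw [zsmul_eq_mul, mul_comm]⟩

/-- The group of lifts acts faithfully on the circle: its elements preserve `zeroBasin`, whose only
integer is `0`, so that none of them is a nontrivial translation. -/
lemma eq_one_of_circleHomeo_eq_one (hn : 3 ≤ n) {g : CircleDeg1Liftˣ} (hg : g ∈ liftGroup n hn)
    (h : circleHomeo g = 1) : g = 1 := by
  have hn' : (0 : ℝ) < n := by positivity
  have key : ∀ y, ∃ q : ℤ, act n g y = y + n * q := fun y => by
    rw [← pt_eq_pt_iff hn, ← circleHomeo_pt hn, h]
    rfl
  have h0 : act n g 0 = 0 := by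
    obtain ⟨q, hq⟩ := key 0
    rw [zero_add] at hq
    have h1 : ((n * q : ℤ) : ℝ) ∈ zeroBasin := by
      push_cast
      rw [← hq, act_mem_zeroBasin hn hg]
      exact ⟨0, rfl⟩
    have := intCast_mem_zeroBasin h1
    rw [hq]
    exact_mod_cast this
  have h1 : ∀ y, act n g y = y := by
    intro y
    obtain ⟨p, ⟨hp1, hp2⟩, -⟩ := existsUnique_add_zsmul_mem_Ico hn' y 0
    obtain ⟨q, hq⟩ := key y
    rw [zsmul_eq_mul, mul_comm] at hp1 hp2
    have h2 := (act_strictMono hn g).monotone hp1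
    have h3 := act_strictMono hn g hp2
    have h4 := act_add_mul hn g 0 1
    rw [Int.cast_one, mul_one] at h4
    rw [h0, act_add_mul hn, hq] at h2
    rw [h4, h0, act_add_mul hn, hq] at h3
    have h5 : (n : ℝ) * q < n * 1 := by linarith
    have h6 : (n : ℝ) * (-1) < n * q := by linarith
    have h7 : (q : ℝ) < 1 := lt_of_mul_lt_mul_left h5 hn'.le
    have h8 : (-1 : ℝ) < q := lt_of_mul_lt_mul_left h6 hn'.le
    have h9 : q = 0 := by
      have : q < 1 := by exact_mod_cast h7
      have : -1 < q := by exact_mod_cast h8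
      omega
    rw [hq, h9]
    simp
  refine Units.ext (CircleDeg1Lift.ext fun x => ?_)
  have := h1 (n * x)
  rw [act, mul_div_cancel_left₀ _ hn'.ne'] at this
  exact mul_left_cancel₀ hn'.ne' this

/-! ### Extreme proximality of the ring group -/

lemma continuous_pt (n : ℕ) : Continuous (pt n) :=
  (AddCircle.continuous_mk' 1).comp (continuous_id.div_const _)

lemma exists_Ioo_pt_mem (hn : 3 ≤ n) {W : Set Circ} (hW : IsOpen W) (hW' : W.Nonempty) :
    ∃ a b : ℝ, a < b ∧ ∀ y ∈ Ioo a b, pt n y ∈ W := by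
  obtain ⟨x, hx⟩ := hW'
  obtain ⟨y, rfl⟩ := exists_pt_eq hn x
  obtain ⟨a, b, hab, h⟩ := mem_nhds_iff_exists_Ioo_subset.1 ((hW.preimage (continuous_pt n)).mem_nhds hx)
  exact ⟨a, b, hab.1.trans hab.2, h⟩

theorem isExtremelyProximal_map_liftGroup (hn : 3 ≤ n) :
    ExtremelyProximal.IsExtremelyProximal ((liftGroup n hn).map circleHomeo) := by
  have hn' : (0 : ℝ) < n := by positivity
  intro W U hW hW' hU hU'
  obtain ⟨a, b, hab, hWab⟩ := exists_Ioo_pt_mem hn hW hW'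
  obtain ⟨c, d, hcd, hUcd⟩ := exists_Ioo_pt_mem hn hU hU'
  obtain ⟨g₁, hg₁, q₁, ha, hb⟩ := exists_act_lt_mul_lt hn hab
  obtain ⟨g₂, hg₂, q₂, hc, hd⟩ := exists_act_lt_mul_lt hn hcd
  obtain ⟨g, hg, hu, hv⟩ := exists_act_nonpos_le_act hn (sub_neg.2 ha) (sub_pos.2 hb)
    (ε := (n * q₂ - act n g₂ c) / 2) (by linarith)
  have shift : ∀ y, act n g (y - n * q₁) = act n g y - n * q₁ := fun y => by
    have := act_add_mul hn g (y - n * q₁) q₁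
    rw [sub_add_cancel] at this
    linarith
  rw [shift, ← act_mul hn] at hu hv
  refine ⟨circleHomeo (g₂⁻¹ * (g * g₁)),
    ⟨_, mul_mem (inv_mem hg₂) (mul_mem hg hg₁), rfl⟩, fun x hx => ?_⟩
  obtain ⟨y, rfl⟩ := exists_pt_eq hn x
  obtain ⟨q, ⟨h1, h2⟩, -⟩ := existsUnique_add_zsmul_mem_Ioc hn' (act n (g * g₁) y)
    (act n (g * g₁) a - n * q₁)
  rw [zsmul_eq_mul, mul_comm (q : ℝ)] at h1 h2
  -- The image of `y` avoids the image of `(a, b)`, hence lies in the short complementary interval.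
  have h3 : act n (g * g₁) b - n * q₁ ≤ act n (g * g₁) y + n * q := by
    by_contra! h3
    refine hx ?_
    have e : act n (g * g₁) (y + n * (q + q₁ : ℤ)) = act n (g * g₁) y + n * q + n * q₁ := by
      rw [act_add_mul hn]
      push_cast
      ring
    have : pt n y = pt n (y + n * (q + q₁ : ℤ)) := (pt_eq_pt_iff hn).2 ⟨_, rfl⟩
    rw [this]
    refine hWab _ ⟨?_, ?_⟩
    · rw [← (act_strictMono hn (g * g₁)).lt_iff_lt, e]
      linarith
    · rw [← (act_strictMono hn (g * g₁)).lt_iff_lt, e]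
      linarith
  rw [circleHomeo_pt hn]
  have e : act n (g₂⁻¹ * (g * g₁)) y + n * (q - 1 + q₂ : ℤ) =
      act n g₂⁻¹ (act n (g * g₁) y + n * q - n + n * q₂) := by
    rw [act_mul hn, ← act_add_mul hn]
    push_cast
    congr 1
    ring
  have : pt n (act n (g₂⁻¹ * (g * g₁)) y) =
      pt n (act n (g₂⁻¹ * (g * g₁)) y + n * (q - 1 + q₂ : ℤ)) := (pt_eq_pt_iff hn).2 ⟨_, rfl⟩
  rw [this, e]
  refine hUcd _ ⟨?_, ?_⟩
  · rw [← (act_strictMono hn g₂).lt_iff_lt, act_act_inv hn]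
    linarith
  · rw [← (act_strictMono hn g₂).lt_iff_lt, act_act_inv hn]
    linarith

/-! ### The fast ring -/

/-- The interval with index `k`, for any integer `k`: the image in the circle of `(k, k + 2)`. -/
noncomputable def arc (n : ℕ) (k : ℤ) : Set Circ := pt n '' Ioo k (k + 2)

/-- The generators of the ring group, indexed by `ZMod n`. -/
noncomputable def ringGen (n : ℕ) (hn : 3 ≤ n) (i : ZMod n) : Circ ≃ₜ Circ :=
  circleHomeo (gen n hn (i.cast : ℤ))

/-- The intervals of the ring, indexed by `ZMod n`. -/
noncomputable def ringArc (n : ℕ) (i : ZMod n) : Set Circ := arc n (i.cast : ℤ)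

lemma isOpenMap_pt (hn : 3 ≤ n) : IsOpenMap (pt n) := by
  have hn' : (n : ℝ) ≠ 0 := by positivity
  exact (QuotientAddGroup.isOpenMap_coe (N := AddSubgroup.zmultiples (1 : ℝ))).comp
    (Homeomorph.mulRight₀ (n : ℝ)⁻¹ (inv_ne_zero hn')).isOpenMap

lemma cast_intCast (k : ℤ) : ((k : ZMod n).cast : ℤ) = k + n * (-(k / n)) := by
  rw [ZMod.coe_intCast, Int.emod_def]
  ring

lemma ringGen_intCast (hn : 3 ≤ n) (k : ℤ) :
    ringGen n hn (k : ZMod n) = circleHomeo (gen n hn k) := by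
  rw [ringGen, cast_intCast, gen_add_mul]

lemma arc_add_mul (hn : 3 ≤ n) (k q : ℤ) : arc n (k + n * q) = arc n k := by
  have key : ∀ k q : ℤ, arc n k ⊆ arc n (k + n * q) := by
    rintro k q _ ⟨y, ⟨h1, h2⟩, rfl⟩
    refine ⟨y + n * q, ⟨?_, ?_⟩, ((pt_eq_pt_iff hn).2 ⟨q, rfl⟩).symm⟩ <;> push_cast <;> linarith
  refine Subset.antisymm ?_ (key k q)
  have := key (k + n * q) (-q)
  rwa [show k + n * q + n * -q = k by ring] at this

lemma ringArc_intCast (hn : 3 ≤ n) (k : ℤ) : ringArc n (k : ZMod n) = arc n k := by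
  rw [ringArc, cast_intCast, arc_add_mul hn]

/-- A multiple of `n` of absolute value less than `3` is zero. -/
lemma eq_zero_of_mul_lt (hn : 3 ≤ n) {q : ℤ} (h1 : -3 < (n : ℝ) * q) (h2 : (n : ℝ) * q < 3) :
    q = 0 := by
  have h1' : -3 < (n : ℤ) * q := by exact_mod_cast h1
  have h2' : (n : ℤ) * q < 3 := by exact_mod_cast h2
  have hn' : (3 : ℤ) ≤ n := by exact_mod_cast hn
  rcases lt_trichotomy q 0 with h | h | h
  · nlinarith
  · exact h
  · nlinarith

lemma arc_inter_arc_succ (hn : 3 ≤ n) (k : ℤ) :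
    arc n k ∩ arc n (k + 1) = pt n '' Ioo (k + 1 : ℝ) (k + 2) := by
  ext x
  constructor
  · rintro ⟨⟨y, ⟨h1, h2⟩, rfl⟩, z, ⟨h3, h4⟩, h5⟩
    push_cast at h3 h4
    obtain ⟨q, hq⟩ := (pt_eq_pt_iff hn).1 h5
    have := eq_zero_of_mul_lt hn (q := q) (by linarith) (by linarith)
    rw [this, Int.cast_zero, mul_zero, add_zero] at hq
    exact ⟨y, ⟨by linarith, h2⟩, rfl⟩
  · rintro ⟨y, ⟨h1, h2⟩, rfl⟩
    exact ⟨⟨y, ⟨by linarith, h2⟩, rfl⟩, y, ⟨by push_cast; linarith, by push_cast; linarith⟩, rfl⟩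

lemma isConnected_arc (k : ℤ) : IsConnected (arc n k) :=
  (isConnected_Ioo (by linarith)).image _ (continuous_pt n).continuousOn

lemma frontier_arc_inter (hn : 3 ≤ n) (k : ℤ) :
    frontier (arc n (k + 1)) ∩ arc n k = {pt n (k + 1)} := by
  have hopen : IsOpen (arc n (k + 1)) := isOpenMap_pt hn _ isOpen_Ioo
  rw [hopen.frontier_eq]
  ext x
  constructor
  · rintro ⟨⟨hx, hx'⟩, z, ⟨h1, h2⟩, rfl⟩
    have hcl : closure (arc n (k + 1)) ⊆ pt n '' Icc ((k + 1 : ℤ) : ℝ) ((k + 1 : ℤ) + 2) :=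
      closure_minimal (image_mono Ioo_subset_Icc_self)
        (isCompact_Icc.image (continuous_pt n)).isClosed
    obtain ⟨y, ⟨h3, h4⟩, h5⟩ := hcl hx
    rcases h3.eq_or_lt with h | h
    · rw [← h5, ← h]
      push_cast
      rfl
    rcases h4.eq_or_lt with h' | h'
    · exfalso
      obtain ⟨q, hq⟩ := (pt_eq_pt_iff hn).1 h5
      push_cast at h'
      have := eq_zero_of_mul_lt hn (q := q) (by linarith) (by linarith)
      rw [this] at hq
      push_cast at hq
      linarith
    · exact absurd ⟨y, ⟨h, h'⟩, h5⟩ hx'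
  · rintro rfl
    refine ⟨⟨?_, ?_⟩, k + 1, ⟨by linarith, by linarith⟩, rfl⟩
    · refine image_closure_subset_closure_image (continuous_pt n) ⟨k + 1, ?_, rfl⟩
      rw [closure_Ioo (by linarith)]
      exact ⟨by push_cast; exact le_rfl, by push_cast; linarith⟩
    · rintro ⟨y, ⟨h1, h2⟩, h3⟩
      obtain ⟨q, hq⟩ := (pt_eq_pt_iff hn).1 h3
      push_cast at h1 h2
      have := eq_zero_of_mul_lt hn (q := q) (by linarith) (by linarith)
      rw [this] at hq
      push_cast at hq
      linarith

lemma support_circleHomeo_gen (hn : 3 ≤ n) (k : ℤ) :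
    {x | circleHomeo (gen n hn k) x ≠ x} = arc n k := by
  ext x
  constructor
  · intro hx
    by_contra hx'
    refine hx ?_
    obtain ⟨y, ⟨h1, h2⟩, rfl⟩ := exists_pt_eq_mem_Ico hn k x
    rw [circleHomeo_pt hn]
    congr 1
    rcases h1.eq_or_lt with h | h
    · rw [← h, act_gen_self]
    · refine act_gen_fix hn ?_ h2.le
      by_contra! h3
      exact hx' ⟨y, ⟨h, h3⟩, rfl⟩
  · rintro ⟨y, ⟨h1, h2⟩, rfl⟩ h
    rw [circleHomeo_pt hn, pt_eq_pt_iff hn] at h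
    obtain ⟨q, hq⟩ := h
    have h3 := lt_act_gen hn h1 h2
    have h4 := act_gen_lt hn h2
    have := eq_zero_of_mul_lt hn (q := q) (by linarith) (by linarith)
    rw [this] at hq
    push_cast at hq
    linarith

/-- Starting from the left endpoint `k + 1` of an interval, the image under successive generators
stays to the right of the break point `k + l + 1 + 1 / 2` of the next generator. -/
lemma run_ringGen (hn : 3 ≤ n) (k : ℤ) (l : ℕ) :
    ∃ y : ℝ, run (ringGen n hn) (k : ZMod n) (pt n (k + 1)) l = pt n y ∧
      k + l + 1 + 1 / 2 ≤ y ∧ y < k + l + 2 := by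
  induction l with
  | zero =>
    refine ⟨act n (gen n hn k) (k + 1), ?_, ?_, ?_⟩
    · rw [run, ringGen_intCast, circleHomeo_pt hn]
    · rw [Nat.cast_zero, add_zero, ← act_gen_half hn k]
      exact (act_strictMono hn _).monotone (by linarith)
    · rw [Nat.cast_zero, add_zero]
      exact act_gen_lt hn (by linarith)
  | succ l ih =>
    obtain ⟨y, hy, h1, h2⟩ := ih
    refine ⟨act n (gen n hn (k + (l + 1 : ℕ))) y, ?_, ?_, ?_⟩
    · rw [run, hy, ← circleHomeo_pt hn, ← ringGen_intCast hn]
      push_cast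
      rfl
    · refine le_trans ?_ ((act_strictMono hn (gen n hn (k + (l + 1 : ℕ)))).monotone
        (show ((k + (l + 1 : ℕ) : ℤ) : ℝ) + 1 / 2 ≤ y by push_cast; linarith))
      rw [act_gen_half]
      push_cast
      linarith
    · have h := act_gen_lt hn (k := k + (l + 1 : ℕ)) (y := y) (by push_cast; linarith)
      push_cast at h ⊢
      linarith

theorem isFastRing (hn : 3 ≤ n) : IsFastRing (ringArc n) (ringGen n hn) where
  isOpen i := isOpenMap_pt hn _ isOpen_Ioo
  isConnected i := isConnected_arc _
  cover := by
    refine eq_univ_of_forall fun x => ?_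
    obtain ⟨y, rfl⟩ := exists_pt_eq hn x
    refine mem_iUnion.2 ⟨((⌈y⌉ - 1 : ℤ) : ZMod n), ?_⟩
    rw [ringArc_intCast hn]
    have h1 := Int.ceil_lt_add_one y
    have h2 := Int.le_ceil y
    exact ⟨y, ⟨by push_cast; linarith, by push_cast; linarith⟩, rfl⟩
  far i j h1 h2 h3 := by
    obtain ⟨k, rfl⟩ : ∃ k : ℤ, (k : ZMod n) = i := ⟨_, ZMod.intCast_zmod_cast i⟩
    obtain ⟨l, rfl⟩ : ∃ l : ℤ, (l : ZMod n) = j := ⟨_, ZMod.intCast_zmod_cast j⟩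
    rw [ringArc_intCast hn, ringArc_intCast hn, Set.disjoint_left]
    rintro _ ⟨y, ⟨h4, h5⟩, rfl⟩ ⟨z, ⟨h6, h7⟩, h8⟩
    obtain ⟨q, hq⟩ := (pt_eq_pt_iff hn).1 h8
    have h9 : k < l + n * q + 2 := by
      have : (k : ℝ) < l + n * q + 2 := by linarith
      exact_mod_cast this
    have h10 : l + n * q < k + 2 := by
      have : (l : ℝ) + n * q < k + 2 := by linarith
      exact_mod_cast this
    have cast_l : ((l + n * q : ℤ) : ZMod n) = l := by simp
    obtain h | h | h : k = l + n * q ∨ l + n * q = k + 1 ∨ k = l + n * q + 1 := by omega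
    · exact h1 (by rw [h, cast_l])
    · exact h2 (by rw [← cast_l, h]; push_cast; rfl)
    · refine h3 ?_
      rw [h, Int.cast_add, cast_l, Int.cast_one]
  near_connected i := by
    obtain ⟨k, rfl⟩ : ∃ k : ℤ, (k : ZMod n) = i := ⟨_, ZMod.intCast_zmod_cast i⟩
    have e : (k : ZMod n) + 1 = ((k + 1 : ℤ) : ZMod n) := by push_cast; rfl
    rw [e, ringArc_intCast hn, ringArc_intCast hn, arc_inter_arc_succ hn]
    exact (isConnected_Ioo (by linarith)).image _ (continuous_pt n).continuousOn
  near_left i := by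
    obtain ⟨k, rfl⟩ : ∃ k : ℤ, (k : ZMod n) = i := ⟨_, ZMod.intCast_zmod_cast i⟩
    have e : (k : ZMod n) + 1 = ((k + 1 : ℤ) : ZMod n) := by push_cast; rfl
    rw [e, ringArc_intCast hn, ringArc_intCast hn]
    refine ⟨inter_subset_left, fun h => ?_⟩
    have h1 := h (show pt n (k + 1 / 2) ∈ arc n k from ⟨_, ⟨by linarith, by linarith⟩, rfl⟩)
    rw [arc_inter_arc_succ hn] at h1
    obtain ⟨y, ⟨h2, h3⟩, h4⟩ := h1
    obtain ⟨q, hq⟩ := (pt_eq_pt_iff hn).1 h4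
    have := eq_zero_of_mul_lt hn (q := q) (by linarith) (by linarith)
    rw [this] at hq
    push_cast at hq
    linarith
  near_right i := by
    obtain ⟨k, rfl⟩ : ∃ k : ℤ, (k : ZMod n) = i := ⟨_, ZMod.intCast_zmod_cast i⟩
    have e : (k : ZMod n) + 1 = ((k + 1 : ℤ) : ZMod n) := by push_cast; rfl
    rw [e, ringArc_intCast hn, ringArc_intCast hn]
    refine ⟨inter_subset_right, fun h => ?_⟩
    have h1 := h (show pt n (k + 5 / 2) ∈ arc n (k + 1) from
      ⟨_, ⟨by push_cast; linarith, by push_cast; linarith⟩, rfl⟩)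
    rw [arc_inter_arc_succ hn] at h1
    obtain ⟨y, ⟨h2, h3⟩, h4⟩ := h1
    obtain ⟨q, hq⟩ := (pt_eq_pt_iff hn).1 h4
    have := eq_zero_of_mul_lt hn (q := q) (by linarith) (by linarith)
    rw [this] at hq
    push_cast at hq
    linarith
  support i := support_circleHomeo_gen hn _
  fast i := by
    obtain ⟨k, rfl⟩ : ∃ k : ℤ, (k : ZMod n) = i := ⟨_, ZMod.intCast_zmod_cast i⟩
    have e : (k : ZMod n) + 1 = ((k + 1 : ℤ) : ZMod n) := by push_cast; rfl
    refine ⟨pt n (k + 1), ?_, fun l _ _ => ?_⟩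
    · rw [e, ringArc_intCast hn, ringArc_intCast hn, frontier_arc_inter hn]
    · obtain ⟨y, hy, h1, h2⟩ := run_ringGen hn k l
      have e' : (k : ZMod n) + l + 1 = ((k + l + 1 : ℤ) : ZMod n) := by push_cast; rfl
      rw [hy, e', ringArc_intCast hn]
      exact ⟨y, ⟨by push_cast; linarith, by push_cast; linarith⟩, rfl⟩

lemma ringGroup_ringGen (hn : 3 ≤ n) :
    ringGroup (ringGen n hn) = (liftGroup n hn).map circleHomeo := by
  rw [ringGroup, liftGroup, MonoidHom.map_closure, ← Set.range_comp]
  congr 1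
  ext g
  constructor
  · rintro ⟨i, rfl⟩
    exact ⟨i.cast, rfl⟩
  · rintro ⟨k, rfl⟩
    exact ⟨k, ringGen_intCast hn k⟩

theorem derivedRingGroup_fg_simple (hn : 3 ≤ n) :
    Group.FG (derivedRingGroup (ringGen n hn)) ∧ IsSimpleGroup (derivedRingGroup (ringGen n hn)) ∧
      ∃ a b : derivedRingGroup (ringGen n hn), ⁅a, b⁆ ≠ 1 := by
  have : NeZero n := ⟨by omega⟩
  have hn' : (3 : ℝ) ≤ n := by exact_mod_cast hn
  have hprox := isExtremelyProximal_map_liftGroup hn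
  rw [← ringGroup_ringGen hn] at hprox
  have : Nontrivial Circ := ⟨pt n 0, pt n 1, fun h => by
    obtain ⟨q, hq⟩ := (pt_eq_pt_iff hn).1 h
    have := eq_zero_of_mul_lt hn (q := q) (by linarith) (by linarith)
    rw [this] at hq
    norm_num at hq⟩
  refine ExtremelyProximal.derived_fg_simple (i := (0 : ZMod n)) hprox (fun i => ?_) ?_ rfl
  · refine ⟨pt n '' Ioo ((i.cast : ℤ) + 2 : ℝ) ((i.cast : ℤ) + 3),
      isOpenMap_pt hn _ isOpen_Ioo, (nonempty_Ioo.2 (by linarith)).image _, ?_⟩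
    rintro _ ⟨y, ⟨h1, h2⟩, rfl⟩
    rw [ringGen, circleHomeo_pt hn, act_gen_fix hn h1.le (by linarith)]
  · intro h
    obtain ⟨x, hx⟩ := (isConnected_arc (n := n) ((0 : ZMod n).cast : ℤ)).nonempty
    rw [← support_circleHomeo_gen hn] at hx
    refine hx ?_
    change ringGen n hn 0 x = x
    rw [h]
    rfl

/-! ### The lift of the action and its translation number -/

/-- A group with a faithful action by increasing homeomorphisms of the line is left orderable:
compare two elements at the first point of a dense sequence where they differ. -/
lemma leftOrderable_of_injective {H : Type*} [Group H] (ρ : H →* CircleDeg1Liftˣ)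
    (hρ : Function.Injective ρ) : LeftOrderable H := by
  set q : ℕ → ℝ := TopologicalSpace.denseSeq ℝ with hq
  have hinj : Function.Injective fun h : H => toLex fun k : ℕ => ρ h (q k) := by
    intro g h hgh
    refine hρ (Units.ext (CircleDeg1Lift.ext ?_))
    refine congrFun (Continuous.ext_on (TopologicalSpace.denseRange_denseSeq ℝ)
      (lift_continuous (ρ g)) (lift_continuous (ρ h)) ?_)
    rintro _ ⟨k, rfl⟩
    exact congrFun (toLex.injective hgh) k
  refine ⟨LinearOrder.lift' (β := Lex (ℕ → ℝ)) (fun h : H => toLex fun k : ℕ => ρ h (q k)) hinj,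
    ?_⟩
  rintro a b c ⟨k, h1, h2⟩
  refine ⟨k, fun j hj => ?_, ?_⟩
  · have : ρ b (q j) = ρ c (q j) := h1 j hj
    change ρ (a * b) (q j) = ρ (a * c) (q j)
    rw [map_mul, map_mul, mul_lift_apply, mul_lift_apply, this]
  · have : ρ b (q k) < ρ c (q k) := h2
    change ρ (a * b) (q k) < ρ (a * c) (q k)
    rw [map_mul, map_mul, mul_lift_apply, mul_lift_apply]
    exact lift_strictMono _ this

lemma isHomogeneousQuasimorphism_transNum {H : Type*} [Group H] (ρ : H →* CircleDeg1Liftˣ) :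
    IsHomogeneousQuasimorphism (transNum ρ) := by
  refine ⟨⟨4, fun g h => ?_⟩, fun g k => ?_⟩
  · have h1 := CircleDeg1Lift.dist_map_zero_translationNumber_le (ρ (g * h) : CircleDeg1Lift)
    have h2 := CircleDeg1Lift.dist_map_zero_translationNumber_le (ρ g : CircleDeg1Lift)
    have h3 := CircleDeg1Lift.dist_map_zero_translationNumber_le (ρ h : CircleDeg1Lift)
    have h4 := CircleDeg1Lift.dist_map_map_zero_lt (ρ g : CircleDeg1Lift) (ρ h : CircleDeg1Lift)
    have h5 : (ρ (g * h) : CircleDeg1Lift) 0 = (ρ g : CircleDeg1Lift) ((ρ h : CircleDeg1Lift) 0) := by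
      rw [map_mul]
      rfl
    rw [Real.dist_eq, abs_le] at h1 h2 h3
    rw [Real.dist_eq, abs_lt] at h4
    rw [h5] at h1
    unfold transNum
    rw [abs_le]
    constructor <;> linarith [h1.1, h1.2, h2.1, h2.2, h3.1, h3.2, h4.1, h4.2]
  · unfold transNum
    rw [map_zpow, CircleDeg1Lift.translationNumber_zpow]

/-- Since a homogeneous quasimorphism is additive on powers, one nonzero value makes it unbounded.
-/
lemma IsHomogeneousQuasimorphism.isUnboundedFun {H : Type*} [Group H] {φ : H → ℝ}
    (hφ : IsHomogeneousQuasimorphism φ) {h : H} (hh : φ h ≠ 0) : IsUnboundedFun φ := by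
  rintro ⟨C, hC⟩
  obtain ⟨m, hm⟩ := exists_nat_gt (C / |φ h|)
  rw [div_lt_iff₀ (abs_pos.2 hh)] at hm
  have h1 := hC (h ^ (m : ℤ))
  rw [hφ.2, abs_mul, Int.cast_natCast, Nat.abs_cast] at h1
  linarith

lemma monoidHom_eq_one_of_isSimpleGroup {H A : Type*} [Group H] [IsSimpleGroup H] [CommGroup A]
    {a b : H} (hab : ⁅a, b⁆ ≠ 1) (ψ : H →* A) (h : H) : ψ h = 1 := by
  have hmem : ⁅a, b⁆ ∈ ψ.ker := by
    rw [MonoidHom.mem_ker, map_commutatorElement, commutatorElement_eq_one_iff_mul_comm, mul_comm]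
  rcases (inferInstance : ψ.ker.Normal).eq_bot_or_eq_top with hk | hk
  · rw [hk, Subgroup.mem_bot] at hmem
    exact absurd hmem hab
  · have : h ∈ ψ.ker := hk ▸ Subgroup.mem_top h
    exact this

/-- The derived subgroup contains lifts that move the point `1 / 2` to `j + 1 / 2`. The generator
with index `j` moves `j + 1 / 2` to `j + 1 + 1 / 2`, and so does its commutator with an element
that conjugates it to a homeomorphism fixing `j + 1 / 2`. -/
lemma exists_derived_act_half (hn : 3 ≤ n) (j : ℕ) :
    ∃ w ∈ ⁅liftGroup n hn, liftGroup n hn⁆, act n w (1 / 2) = j + 1 / 2 := by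
  induction j with
  | zero => exact ⟨1, one_mem _, by rw [act_one hn]; simp⟩
  | succ j ih =>
    obtain ⟨w, hw, hwj⟩ := ih
    have hn' : (3 : ℝ) ≤ n := by exact_mod_cast hn
    set u := gen n hn (j + 1 : ℤ) * gen n hn j with hu
    have hu' : u ∈ liftGroup n hn := mul_mem (gen_mem hn _) (gen_mem hn _)
    have h1 := act_gen_half hn (j : ℤ)
    have h2 := act_gen_half hn (j + 1 : ℤ)
    push_cast at h1 h2
    have h3 : act n u (j + 1 / 2) = j + 1 + 1 + 1 / 2 := by rw [hu, act_mul hn, h1, h2]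
    have h4 : act n (gen n hn j) (j + 1 + 1 + 1 / 2) = j + 1 + 1 + 1 / 2 :=
      act_gen_fix hn (by push_cast; linarith) (by push_cast; linarith)
    have h5 : act n (gen n hn j)⁻¹ (j + 1 + 1 + 1 / 2) = j + 1 + 1 + 1 / 2 := by
      conv_lhs => rw [← h4]
      exact act_inv_act hn _ _
    have h6 : act n u⁻¹ (j + 1 + 1 + 1 / 2) = j + 1 / 2 := by
      rw [← h3]
      exact act_inv_act hn _ _
    refine ⟨⁅gen n hn j, u⁻¹⁆ * w, mul_mem
      (Subgroup.commutator_mem_commutator (gen_mem hn _) (inv_mem hu')) hw, ?_⟩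
    rw [act_mul hn, hwj, commutatorElement_def, inv_inv, act_mul hn, act_mul hn, act_mul hn, h3, h5,
      h6, h1]
    push_cast
    ring

/-- The canonical lift of the action of the derived subgroup. -/
theorem exists_lift (hn : 3 ≤ n) : ∃ ρ : derivedRingGroup (ringGen n hn) →* CircleDeg1Liftˣ,
    (∀ h, circleHomeo (ρ h) = (h : Circ ≃ₜ Circ)) ∧ ∀ h, ρ h ∈ liftGroup n hn := by
  set φ : liftGroup n hn →* (Circ ≃ₜ Circ) := circleHomeo.comp (liftGroup n hn).subtype with hφ
  have hinj : Function.Injective φ := (injective_iff_map_eq_one φ).2 fun g hg =>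
    Subtype.ext (eq_one_of_circleHomeo_eq_one hn g.2 hg)
  have hle : derivedRingGroup (ringGen n hn) ≤ φ.range := by
    refine (Subgroup.commutator_le_self _).trans ?_
    rw [ringGroup_ringGen, hφ, MonoidHom.range_comp, Subgroup.range_subtype]
  refine ⟨(liftGroup n hn).subtype.comp
    ((MonoidHom.ofInjective hinj).symm.toMonoidHom.comp (Subgroup.inclusion hle)),
    fun h => ?_, fun h => ?_⟩
  · exact MonoidHom.apply_ofInjective_symm hinj (Subgroup.inclusion hle h)
  · exact ((MonoidHom.ofInjective hinj).symm (Subgroup.inclusion hle h)).2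

end RingGroup

theorem corollary1p6 (n : ℕ) (hn : 3 ≤ n) :
    ∃ (J : ZMod n → Set Circ) (f : ZMod n → (Circ ≃ₜ Circ)),
      RingGroup.IsFastRing J f ∧
      Group.FG (RingGroup.derivedRingGroup f) ∧
      IsSimpleGroup (RingGroup.derivedRingGroup f) ∧
      LeftOrderable (RingGroup.derivedRingGroup f) ∧
      ∃ ρ : RingGroup.derivedRingGroup f →* CircleDeg1Liftˣ,
        RingGroup.IsLift (RingGroup.derivedRingGroup f) ρ ∧
        Function.Injective ρ ∧
        IsHomogeneousQuasimorphism (RingGroup.transNum ρ) ∧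
        IsUnboundedFun (RingGroup.transNum ρ) ∧
        IsNontrivialQuasimorphism (RingGroup.transNum ρ) := by
  obtain ⟨hfg, hsimple, a, b, hab⟩ := RingGroup.derivedRingGroup_fg_simple hn
  obtain ⟨ρ, hρ, hρmem⟩ := RingGroup.exists_lift hn
  have hinj : Function.Injective ρ := fun g h hgh => Subtype.ext (by rw [← hρ g, hgh, hρ h])
  have hhom := RingGroup.isHomogeneousQuasimorphism_transNum ρ
  have hunb : IsUnboundedFun (RingGroup.transNum ρ) := by
    have hn' : (n : ℝ) ≠ 0 := by positivity
    obtain ⟨w, hw, hwn⟩ := RingGroup.exists_derived_act_half hn n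
    have hmem : RingGroup.circleHomeo w ∈ RingGroup.derivedRingGroup (RingGroup.ringGen n hn) := by
      rw [RingGroup.derivedRingGroup, RingGroup.ringGroup_ringGen, ← Subgroup.map_commutator]
      exact ⟨w, hw, rfl⟩
    have hρw : ρ ⟨_, hmem⟩ = w := by
      rw [← mul_inv_eq_one]
      refine RingGroup.eq_one_of_circleHomeo_eq_one hn (mul_mem (hρmem _)
        (inv_mem (Subgroup.commutator_le_self _ hw))) ?_
      rw [map_mul, hρ, map_inv, mul_inv_cancel]
    have htrans : RingGroup.transNum ρ ⟨_, hmem⟩ = 1 := by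
      rw [RingGroup.transNum, hρw]
      have h : (w : CircleDeg1Lift) (1 / 2 / n) = 1 / 2 / n + (1 : ℤ) := by
        rw [RingGroup.act] at hwn
        field_simp at hwn ⊢
        push_cast
        linarith
      rw [CircleDeg1Lift.translationNumber_of_eq_add_int _ h, Int.cast_one]
    exact RingGroup.IsHomogeneousQuasimorphism.isUnboundedFun hhom (by rw [htrans]; exact one_ne_zero)
  refine ⟨RingGroup.ringArc n, RingGroup.ringGen n hn, RingGroup.isFastRing hn, hfg, hsimple,
    RingGroup.leftOrderable_of_injective ρ hinj, ρ, fun h t => ?_, hinj, hhom, hunb, hhom.1,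
    fun ψ => ?_⟩
  · rw [← hρ h]
    exact (RingGroup.circleHomeo_coe (ρ h) t).symm
  · have : ∀ h, Multiplicative.toAdd (ψ h) = 0 := fun h => by
      rw [RingGroup.monoidHom_eq_one_of_isSimpleGroup hab ψ h, toAdd_one]
    simpa only [this, sub_zero] using hunb
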